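/- \textbf{Setting.} Let $\mathcal W\subseteq\mathbb R^{n_w}$, $\mathcal D\subseteq\mathbb R^{d_D}$, $\mathcal M\subseteq\mathbb R^{n_\mu}$, $\mathcal Z\subseteq\mathbb R^{d_z}$ be closed convex sets, and let $\phi:\mathcal W\times\mathcal D^N\times\mathcal M\times\mathcal Z^N\to\mathbb R$ be jointly convex in its first two arguments and jointly concave in its last two. All norms are Euclidean. A weighted digraph on $\{1,\dots,N\}$ is given by a nonnegative adjacency matrix $A=(a_{ij})$, with $(i,j)$ an edge iff $a_{ij}>0$; its out-degrees are $d_{\rm out}(i)=\sum_j a_{ij}$, its Laplacian is $L=\operatorname{diag}(A\mathbf 1)-A$, and it is weight-balanced if $\sum_j a_{ij}=\sum_j a_{ji}$ for all $i$. Let $\mathcal G_t$, $t\ge1$, be weight-balanced digraphs on $\{1,\dots,N\}$ with adjacency matrices $A_t=(a_{ij,t})$ and Laplacians $L_t$, which are $\delta$-nondegenerate for some $\delta>0$ (every positive weight $a_{ij,t}$ is $>\delta$) and $B$-jointly connected for some integer $B\ge1$ (for each $k\ge1$ the union of $\mathcal G_{kB},\dots,\mathcal G_{(k+1)B-1}$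 is strongly connected). Assume that the maximum singular values satisfy $\sigma_{\max}(L_t)\le\overline\Lambda$ for all $t\ge 1$, and that the supremum $d_{\max}$ of the out-degrees over all vertices and all times $t\ge1$ is finite. Let $\tilde\delta'\in(0,1)$, $\tilde\delta:=\min\{\tilde\delta',(1-\tilde\delta')\,\delta/d_{\max}\}$, and let the consensus stepsize $\sigma>0$ satisfy $$\sigma\in\Big[\frac{\tilde\delta}{\delta},\ \frac{1-\tilde\delta}{d_{\max}}\Big],\qquad\text{and put}\qquad C_u:=\frac{2^5/3^2}{1-\big(1-\frac{\tilde\delta}{4N^2}\big)^{1/B}} .$$ \textbf{Dynamics.} Let $S=\mathcal W\times\mathcal D^N\times\mathcal M\times\mathcal Z^N$, let $P_S$ be the orthogonal projection onto $S$, and let $(w_1,D_1,\mu_1,z_1)\in S$. For $t\ge1$ let $$(w_{t+1},D_{t+1},\mu_{t+1},z_{t+1})=P_S\big(w_t-\eta_tg_{w_t},\ D_t-\sigma\mathbf L_tD_t-\eta_tg_{D_t},\ \mu_t+\eta_tg_{\mu_t},\ z_t-\sigma\mathbf L_tz_t+\eta_tg_{z_t}\big),$$ where $\mathbf L_t=L_t\otimes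 I$ with the identity of dimension $d_D$ or $d_z$, where $(g_{w_t},g_{D_t})$ is a subgradient at $(w_t,D_t)$ of the convex function $\phi(\cdot,\cdot,\mu_t,z_t)$ on $\mathcal W\times\mathcal D^N$, and where $(g_{\mu_t},g_{z_t})$ is a subgradient at $(\mu_t,z_t)$ of the concave function $\phi(w_t,D_t,\cdot,\cdot)$ on $\mathcal M\times\mathcal Z^N$ (that is, $-(g_{\mu_t},g_{z_t})$ is a subgradient of the convex function $-\phi(w_t,D_t,\cdot,\cdot)$). The learning rates follow the Doubling Trick: $\eta_s=1/\sqrt{2^m}$ for $2^m\le s\le 2^{m+1}-1$, $m=0,1,2,\dots$ Assume that for all $t\ge1$ $$\|w_t\|\le B_w,\ \|D_t\|\le B_D,\ \|\mu_t\|\le B_\mu,\ \|z_t\|\le B_z,\quad \|g_{w_t}\|\le H_w,\ \|g_{D_t}\|\le H_D,\ \|g_{\mu_t}\|\le H_\mu,\ \|g_{z_t}\|\le H_z .$$ \textbf{Theorem.} Let $(w^*,D^*,\mu^*,z^*)$ be any saddle point of $\phi$ on $S$ (minimum in $(w,D)$, maximum in $(\mu,z)$) such that all $N$ blocks of $D^*$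 are equal and all $N$ blocks of $z^*$ are equal. For $t\ge2$ let $w^{\rm av}_t=\frac1{t-1}\sum_{s=1}^{t-1}w_s$, and define $D^{\rm av}_t,\mu^{\rm av}_t,z^{\rm av}_t$ likewise. Then for all $t\ge2$ $$-\frac{C_{\mu,z}+C_{w,D}}{2\sqrt{t-1}}\ \le\ \phi(w^{\rm av}_t,D^{\rm av}_t,\mu^{\rm av}_t,z^{\rm av}_t)-\phi(w^*,D^*,\mu^*,z^*)\ \le\ \frac{C_{w,D}+C_{\mu,z}}{2\sqrt{t-1}},$$ where $$C_{w,D}:=\frac{\sqrt2}{\sqrt2-1}\Big(4(B_w^2+B_D^2)+6(H_w^2+H_D^2)+H_D(3+\sigma\overline\Lambda)\,C_u\,(B_D+2H_D)\Big)$$ and $C_{\mu,z}$ is defined in the same way with $(\mu,z)$ in place of $(w,D)$. -/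

import Mathlib

noncomputable section

namespace SaddleAveraging

/-! ### Weighted digraphs -/

/-- A weighted digraph on the vertex set `Fin N`, given by its nonnegative weighted adjacency
matrix; `(i, j)` is an edge if and only if the entry `(i, j)` is positive. -/
structure WDigraph (N : ℕ) where
  adj : Matrix (Fin N) (Fin N) ℝ
  adj_nonneg : ∀ i j, 0 ≤ adj i j

namespace WDigraph

variable {N : ℕ}

/-- The edge relation. -/
def Edge (G : WDigraph N) (i j : Fin N) : Prop := 0 < G.adj i j

/-- The union of finitely many digraphs: adjacency matrices are added, so edge sets are united. -/
def union (G : ℕ → WDigraph N) (s : Finset ℕ) : WDigraph N where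
  adj := ∑ t ∈ s, (G t).adj
  adj_nonneg i j := by
    rw [Matrix.sum_apply]
    exact Finset.sum_nonneg fun t _ => (G t).adj_nonneg i j

/-- There is a directed path between any pair of distinct vertices. -/
def StronglyConnected (G : WDigraph N) : Prop :=
  ∀ i j, i ≠ j → Relation.TransGen G.Edge i j

/-- The weighted out-degree. -/
def outDegree (G : WDigraph N) (i : Fin N) : ℝ := ∑ j, G.adj i j

/-- The weighted in-degree. -/
def inDegree (G : WDigraph N) (i : Fin N) : ℝ := ∑ j, G.adj j i

/-- In- and out-degree agree at every vertex. -/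
def WeightBalanced (G : WDigraph N) : Prop := ∀ i, G.outDegree i = G.inDegree i

/-- The Laplacian matrix `diag(A 𝟙) - A`. -/
def laplacian (G : WDigraph N) : Matrix (Fin N) (Fin N) ℝ :=
  Matrix.diagonal G.outDegree - G.adj

end WDigraph

/-- A sequence of digraphs, indexed by the times `t ≥ 1`, is `δ`-nondegenerate if all positive
weights exceed `δ`. -/
def Nondegenerate {N : ℕ} (G : ℕ → WDigraph N) (δ : ℝ) : Prop :=
  ∀ t, 1 ≤ t → ∀ i j, 0 < (G t).adj i j → δ < (G t).adj i j

/-- A sequence of digraphs, indexed by the times `t ≥ 1`, is `B`-jointly connected if for every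
`k ≥ 1` the union of the digraphs at the times `kB, …, (k+1)B - 1` is strongly connected. -/
def JointlyConnected {N : ℕ} (G : ℕ → WDigraph N) (B : ℕ) : Prop :=
  ∀ k, 1 ≤ k → (WDigraph.union G (Finset.Ico (k * B) ((k + 1) * B))).StronglyConnected

/-- The set of all weighted out-degrees over all vertices and all times `t ≥ 1`. -/
def outDegrees {N : ℕ} (G : ℕ → WDigraph N) : Set ℝ :=
  {r | ∃ t, 1 ≤ t ∧ ∃ i, r = (G t).outDegree i}

/-- The maximal weighted out-degree over all vertices and all times `t ≥ 1`. -/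
def maxOutDegree {N : ℕ} (G : ℕ → WDigraph N) : ℝ := sSup (outDegrees G)

/-- The maximum singular value of a real square matrix. -/
def sigmaMax {N : ℕ} (A : Matrix (Fin N) (Fin N) ℝ) : ℝ :=
  (Matrix.toEuclideanLin A).singularValues 0

/-! ### Stacked vectors -/

/-- Stacked vectors `(x¹, …, x^N)` in `(ℝ^d)^N`, with the Euclidean norm. -/
abbrev Stack (N d : ℕ) : Type := PiLp 2 (fun _ : Fin N => EuclideanSpace ℝ (Fin d))

/-- The Cartesian power `S^N`. -/
def stackSet (N : ℕ) {d : ℕ} (S : Set (EuclideanSpace ℝ (Fin d))) : Set (Stack N d) :=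
  {x | ∀ i, x i ∈ S}

/-- The stacked vector all of whose blocks are equal to `x`. -/
def agree (N : ℕ) {d : ℕ} (x : EuclideanSpace ℝ (Fin d)) : Stack N d :=
  WithLp.toLp 2 (fun _ => x)

/-- The action of `A ⊗ I_d` on stacked vectors: the `i`-th block is `∑ⱼ Aᵢⱼ xʲ`. -/
def blockAct {N d : ℕ} (A : Matrix (Fin N) (Fin N) ℝ) (x : Stack N d) : Stack N d :=
  WithLp.toLp 2 (fun i => ∑ j, A i j • x j)

/-! ### Optimization notions -/

/-- `p` is the orthogonal projection of `x` onto `S`, i.e. the point of `S` closest to `x`. -/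
def IsProjection {E : Type*} [NormedAddCommGroup E] (S : Set E) (x p : E) : Prop :=
  p ∈ S ∧ ∀ y ∈ S, ‖x - p‖ ≤ ‖x - y‖

/-- `g` is a subgradient at `x` of the function `f` on `S`. -/
def IsSubgradient {E : Type*} [NormedAddCommGroup E] [InnerProductSpace ℝ E]
    (S : Set E) (f : E → ℝ) (x g : E) : Prop :=
  x ∈ S ∧ ∀ y ∈ S, inner ℝ g (y - x) ≤ f y - f x

/-- `g` is a subgradient at `x` of the concave function `f` on `S`, i.e. `-g` is a subgradient
of `-f`. -/
def IsConcaveSubgradient {E : Type*} [NormedAddCommGroup E] [InnerProductSpace ℝ E]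
    (S : Set E) (f : E → ℝ) (x g : E) : Prop :=
  IsSubgradient S (fun y => -f y) x (-g)

/-- The product of two Euclidean spaces, with the Euclidean norm. -/
abbrev Pair (E F : Type*) : Type _ := WithLp 2 (E × F)

/-- The Euclidean pair `(x, y)`. -/
abbrev pair {E F : Type*} (x : E) (y : F) : Pair E F := WithLp.toLp 2 (x, y)

/-- The product `S × T`, as a set of Euclidean pairs. -/
def pairSet {E F : Type*} (S : Set E) (T : Set F) : Set (Pair E F) :=
  {p | p.fst ∈ S ∧ p.snd ∈ T}

/-! ### The saddle-point problem and the dynamics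

The primal variable is the pair `(w, D)` and the dual variable is the pair `(μ, z)`, with
`w ∈ ℝ^nw`, `D ∈ (ℝ^dD)^N`, `μ ∈ ℝ^nm` and `z ∈ (ℝ^dz)^N`. -/

/-- The type of real functions of `(w, D, μ, z)`; only their values on the constraint set are
ever used. -/
abbrev Payoff (N nw dD nm dz : ℕ) : Type :=
  EuclideanSpace ℝ (Fin nw) → Stack N dD → EuclideanSpace ℝ (Fin nm) → Stack N dz → ℝ

/-- `φ` is jointly convex in the first two arguments and jointly concave in the last two on
`W × 𝒟^N × M × 𝒵^N`. -/
def ConvexConcave {N nw dD nm dz : ℕ} (φ : Payoff N nw dD nm dz)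
    (W : Set (EuclideanSpace ℝ (Fin nw))) (𝒟 : Set (EuclideanSpace ℝ (Fin dD)))
    (M : Set (EuclideanSpace ℝ (Fin nm))) (𝒵 : Set (EuclideanSpace ℝ (Fin dz))) : Prop :=
  (∀ μ ∈ M, ∀ z ∈ stackSet N 𝒵,
    ConvexOn ℝ (pairSet W (stackSet N 𝒟)) (fun p => φ p.fst p.snd μ z)) ∧
  (∀ w ∈ W, ∀ D ∈ stackSet N 𝒟,
    ConcaveOn ℝ (pairSet M (stackSet N 𝒵)) (fun q => φ w D q.fst q.snd))

/-- `(w, D, μ, z)` is a saddle point of `φ` on `W × 𝒟^N × M × 𝒵^N`: minimum in `(w, D)`,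
maximum in `(μ, z)`. -/
def IsSaddle {N nw dD nm dz : ℕ} (φ : Payoff N nw dD nm dz)
    (W : Set (EuclideanSpace ℝ (Fin nw))) (𝒟 : Set (EuclideanSpace ℝ (Fin dD)))
    (M : Set (EuclideanSpace ℝ (Fin nm))) (𝒵 : Set (EuclideanSpace ℝ (Fin dz)))
    (w : EuclideanSpace ℝ (Fin nw)) (D : Stack N dD)
    (μ : EuclideanSpace ℝ (Fin nm)) (z : Stack N dz) : Prop :=
  pair w D ∈ pairSet W (stackSet N 𝒟) ∧ pair μ z ∈ pairSet M (stackSet N 𝒵) ∧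
  IsSaddlePointOn (pairSet W (stackSet N 𝒟)) (pairSet M (stackSet N 𝒵))
    (fun p q => φ p.fst p.snd q.fst q.snd) (pair w D) (pair μ z)

/-- The sequence `(w t, D t, μ t, z t)`, `t ≥ 1`, is generated by the projected saddle-point
subgradient dynamics with Laplacian averaging over the digraphs `G t`, with consensus stepsize
`σ`, learning rates `η t` and subgradients `gw t, gD t, gμ t, gz t`. -/
structure IsDynamics {N nw dD nm dz : ℕ} (φ : Payoff N nw dD nm dz)
    (W : Set (EuclideanSpace ℝ (Fin nw))) (𝒟 : Set (EuclideanSpace ℝ (Fin dD)))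
    (M : Set (EuclideanSpace ℝ (Fin nm))) (𝒵 : Set (EuclideanSpace ℝ (Fin dz)))
    (G : ℕ → WDigraph N) (σ : ℝ) (η : ℕ → ℝ)
    (w : ℕ → EuclideanSpace ℝ (Fin nw)) (D : ℕ → Stack N dD)
    (μ : ℕ → EuclideanSpace ℝ (Fin nm)) (z : ℕ → Stack N dz)
    (gw : ℕ → EuclideanSpace ℝ (Fin nw)) (gD : ℕ → Stack N dD)
    (gμ : ℕ → EuclideanSpace ℝ (Fin nm)) (gz : ℕ → Stack N dz) : Prop where
  /-- The initial state lies in the constraint set. -/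
  init : w 1 ∈ W ∧ D 1 ∈ stackSet N 𝒟 ∧ μ 1 ∈ M ∧ z 1 ∈ stackSet N 𝒵
  /-- `gw t`, `gD t` are the blocks of a subgradient of `φ` in its convex variable `(w, D)`. -/
  primal_subgradient : ∀ t, 1 ≤ t →
    IsSubgradient (pairSet W (stackSet N 𝒟)) (fun p => φ p.fst p.snd (μ t) (z t))
      (pair (w t) (D t)) (pair (gw t) (gD t))
  /-- `gμ t`, `gz t` are the blocks of a subgradient of `φ` in its concave variable `(μ, z)`. -/
  dual_subgradient : ∀ t, 1 ≤ t →
    IsConcaveSubgradient (pairSet M (stackSet N 𝒵)) (fun q => φ (w t) (D t) q.fst q.snd)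
      (pair (μ t) (z t)) (pair (gμ t) (gz t))
  /-- A subgradient step combined with Laplacian averaging of `D` and `z`, followed by the
  orthogonal projection onto `W × 𝒟^N × M × 𝒵^N`. -/
  step : ∀ t, 1 ≤ t →
    IsProjection
      (pairSet (pairSet W (stackSet N 𝒟)) (pairSet M (stackSet N 𝒵)))
      (pair
        (pair (w t - η t • gw t) (D t - σ • blockAct (G t).laplacian (D t) - η t • gD t))
        (pair (μ t + η t • gμ t) (z t - σ • blockAct (G t).laplacian (z t) + η t • gz t)))
      (pair (pair (w (t + 1)) (D (t + 1))) (pair (μ (t + 1)) (z (t + 1))))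

/-- The Doubling Trick: the learning rate is `1 / √(2^m)` during the `m`-th epoch
`2^m, …, 2^(m+1) - 1`, for `m = 0, 1, 2, …`. -/
def IsDoublingTrick (η : ℕ → ℝ) : Prop :=
  ∀ m s : ℕ, 2 ^ m ≤ s → s < 2 ^ (m + 1) → η s = 1 / √(2 ^ m)

/-- The running time-average at time `t ≥ 2`: `(x 1 + ⋯ + x (t - 1)) / (t - 1)`. -/
def timeAvg {E : Type*} [AddCommGroup E] [Module ℝ E] (x : ℕ → E) (t : ℕ) : E :=
  (1 / ((t : ℝ) - 1)) • ∑ s ∈ Finset.Ico 1 t, x s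

/-! ### Constants -/

/-- `min {δ', (1 - δ') δ / d_max}`. -/
def deltaTilde (δ' δ dmax : ℝ) : ℝ := min δ' ((1 - δ') * (δ / dmax))

/-- The disagreement constant `C_u`, where `d` stands for `δ̃`. -/
def Cu (N B : ℕ) (d : ℝ) : ℝ :=
  (2 ^ 5 / 3 ^ 2) / (1 - (1 - d / (4 * (N : ℝ) ^ 2)) ^ (1 / (B : ℝ)))

/-- The constant of the evaluation error; `bx`, `hx` bound the first variable and its
subgradients, `by'`, `hy` bound the variable subject to agreement and its subgradients, and `c`
is the disagreement constant. -/
def evalConst (bx by' hx hy σ Λ c : ℝ) : ℝ :=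
  √2 / (√2 - 1) *
    (4 * (bx ^ 2 + by' ^ 2) + 6 * (hx ^ 2 + hy ^ 2) + hy * (3 + σ * Λ) * c * (by' + 2 * hy))

end SaddleAveraging

end

open SaddleAveraging

namespace SaddleAveraging

open Finset Matrix

/-! ### Doubly stochastic matrices and sums of squares -/

/-! Each player runs projected subgradient descent in which the stacked variable is first averaged
by `P t = 1 - σ • L t`. Weight balance and the range of `σ` make `P t` doubly stochastic, with
diagonal and nonzero entries at least `δ̃`.

Consensus. A doubly stochastic matrix lowers a sum of squares by the sum of the variances taken
along its rows. Sort the initial values and look at each gap between consecutive ones: when an edge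
first joins its two sides, a fixed fraction of the squared gap is lost. Over a jointly connected
window every gap is crossed, so `sum_sq_window_le` gives a contraction. The disagreement therefore
decays geometrically (`IsConsensus.norm_evolve_le_geometric`). Since the gradient steps perturb it
by at most `η t * HD`, its sum up to time `T` is `O(√T)` (`IsDescent.sum_disagreement_le`).

Regret. `IsDescent.regret_le` bounds the regret against every comparator, in agreement or not,
because distances are measured to the comparator's agreed mean, at a price linear in its
disagreement. Time averages of the iterates have disagreement `O(1/√T)`, so they are cheap
comparators, and their norms obey the bounds on the iterates.

Saddle value. Using the saddle point as comparator at horizon `T` would bring its norm into the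
constant. `two_mul_value_sub_le` passes instead through the primal average at a longer horizon `S`
and uses the saddle point only there; as `S → ∞` its contribution vanishes. This gives the upper
bound, and exchanging the players gives the lower one. -/

lemma variance_eq_sum_sq_sub {ι : Type*} [Fintype ι] {p : ι → ℝ} (hp : ∑ i, p i = 1)
    (x : ι → ℝ) :
    (1 / 2) * ∑ i, ∑ j, p i * p j * (x i - x j) ^ 2 =
      ∑ i, p i * x i ^ 2 - (∑ i, p i * x i) ^ 2 := by
  have h1 : ∀ i j, p i * p j * (x i - x j) ^ 2 =
      (p i * x i ^ 2) * p j + p i * (p j * x j ^ 2) - 2 * ((p i * x i) * (p j * x j)) := by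
    intro i j; ring
  simp_rw [h1, sum_sub_distrib, sum_add_distrib, ← mul_sum, ← sum_mul, hp]
  ring

/-- Row sums 1 make each row a probability vector, whose variance is the Jensen deficit of that row;
column sums 1 recover `∑ i, x i ^ 2` from the second moments. -/
lemma sum_sq_sub_sum_sq_mulVec {ι : Type*} [Fintype ι] [DecidableEq ι] {P : Matrix ι ι ℝ}
    (hP : P ∈ doublyStochastic ℝ ι) (x : ι → ℝ) :
    ∑ i, x i ^ 2 - ∑ k, (P *ᵥ x) k ^ 2 =
      ∑ k, (1 / 2) * ∑ i, ∑ j, P k i * P k j * (x i - x j) ^ 2 := by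
  obtain ⟨-, hrow, hcol⟩ := mem_doublyStochastic_iff_sum.1 hP
  simp_rw [fun k => variance_eq_sum_sq_sub (hrow k) x, sum_sub_distrib]
  congr 1
  rw [sum_comm]
  refine sum_congr rfl fun i _ => ?_
  rw [← sum_mul, hcol, one_mul]

lemma sum_sq_mulVec_le {ι : Type*} [Fintype ι] [DecidableEq ι] {P : Matrix ι ι ℝ}
    (hP : P ∈ doublyStochastic ℝ ι) (x : ι → ℝ) :
    ∑ k, (P *ᵥ x) k ^ 2 ≤ ∑ i, x i ^ 2 := by
  have hnn := (mem_doublyStochastic_iff_sum.1 hP).1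
  rw [← sub_nonneg, sum_sq_sub_sum_sq_mulVec hP]
  exact sum_nonneg fun k _ => mul_nonneg (by norm_num) <| sum_nonneg fun i _ =>
    sum_nonneg fun j _ => mul_nonneg (mul_nonneg (hnn _ _) (hnn _ _)) (sq_nonneg _)

/-- A crossing edge forces the sum of squares of the indicator of a cut to decrease. -/
lemma half_le_sum_sq_sub_of_cut {ι : Type*} [Fintype ι] [DecidableEq ι] {P : Matrix ι ι ℝ}
    (hP : P ∈ doublyStochastic ℝ ι) {η : ℝ} (U : ι → Prop) [DecidablePred U] {k l : ι}
    (hk : η ≤ P k k) (hl : η ≤ P k l) (hkl : U k ↔ ¬ U l) :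
    η / 2 ≤ ∑ i, (if U i then (1 : ℝ) else 0) ^ 2 -
      ∑ i, (P *ᵥ fun i => if U i then (1 : ℝ) else 0) i ^ 2 := by
  obtain ⟨hnn, hrow, -⟩ := mem_doublyStochastic_iff_sum.1 hP
  rw [sum_sq_sub_sum_sq_mulVec hP]
  refine le_trans ?_ (single_le_sum (f := fun k => (1 / 2 : ℝ) * ∑ i, ∑ j, P k i * P k j *
    ((if U i then (1 : ℝ) else 0) - (if U j then (1 : ℝ) else 0)) ^ 2)
    (fun k _ => mul_nonneg (by norm_num) <| sum_nonneg fun i _ =>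
      sum_nonneg fun j _ => mul_nonneg (mul_nonneg (hnn _ _) (hnn _ _)) (sq_nonneg _))
    (mem_univ k))
  rw [variance_eq_sum_sq_sub (hrow k)]
  have h1 : ∀ i, P k i * (if U i then (1 : ℝ) else 0) ^ 2 = if U i then P k i else 0 := by
    intro i; split_ifs <;> simp
  have h2 : ∀ i, P k i * (if U i then (1 : ℝ) else 0) = if U i then P k i else 0 := by
    intro i; split_ifs <;> simp
  simp_rw [h1, h2]
  have h3 : ∑ i, (if U i then P k i else 0) + ∑ i, (if U i then 0 else P k i) = 1 := by
    rw [← sum_add_distrib, ← hrow k]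
    refine sum_congr rfl fun i _ => ?_
    split_ifs <;> simp
  have h4 : ∀ i, (if U i then P k i else 0) ≤ ∑ i, (if U i then P k i else 0) := fun i =>
    single_le_sum (f := fun i => if U i then P k i else 0)
      (fun i _ => by split_ifs <;> simp [hnn]) (mem_univ i)
  have h5 : ∀ i, (if U i then 0 else P k i) ≤ ∑ i, (if U i then 0 else P k i) := fun i =>
    single_le_sum (f := fun i => if U i then 0 else P k i)
      (fun i _ => by split_ifs <;> simp [hnn]) (mem_univ i)
  set s := ∑ i, (if U i then P k i else 0)
  set s' := ∑ i, (if U i then 0 else P k i)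
  have h6 : η ≤ s ∧ η ≤ s' := by
    by_cases hU : U k
    · have hUl := hkl.1 hU
      exact ⟨by have := h4 k; rw [if_pos hU] at this; linarith,
        by have := h5 l; rw [if_neg hUl] at this; linarith⟩
    · have hUl : U l := by tauto
      exact ⟨by have := h4 l; rw [if_pos hUl] at this; linarith,
        by have := h5 k; rw [if_neg hU] at this; linarith⟩
  have h0 : 0 ≤ s := sum_nonneg fun i _ => by split_ifs <;> simp [hnn]
  have h0' : 0 ≤ s' := sum_nonneg fun i _ => by split_ifs <;> simp [hnn]
  -- The decrease is `s - s ^ 2 = s * s'`: the larger factor is at least 1/2, the smaller at least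
  -- `η`.
  rcases le_total s s' with h | h
  · nlinarith [h6.1, h6.2]
  · nlinarith [h6.1, h6.2]

/-! ### Gaps of a monotone sequence -/

/-- The gaps are non-overlapping intervals inside `[a, b]`. Removing the largest index `m` shrinks
the right end to `z m`. -/
lemma sum_gap_le {z : ℕ → ℝ} (hz : Monotone z) (A : Finset ℕ) {a b : ℝ} (hab : a ≤ b)
    (hA : ∀ d ∈ A, a ≤ z d ∧ z (d + 1) ≤ b) : ∑ d ∈ A, (z (d + 1) - z d) ≤ b - a := by
  induction A using Finset.induction_on_max generalizing b with
  | empty => simpa using hab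
  | insert m A hm ih =>
    have hmA : m ∉ A := fun h => lt_irrefl _ (hm m h)
    obtain ⟨h1, h2⟩ := hA m (mem_insert_self _ _)
    have := ih h1 fun d hd => ⟨(hA d (mem_insert_of_mem hd)).1, hz (hm d hd)⟩
    rw [sum_insert hmA]
    linarith

lemma sum_gap_sq_le {z : ℕ → ℝ} (hz : Monotone z) (A : Finset ℕ) {a b : ℝ}
    (hA : ∀ d ∈ A, a ≤ z d ∧ z (d + 1) ≤ b) :
    ∑ d ∈ A, (z (d + 1) - z d) ^ 2 ≤ (b - a) ^ 2 := by
  have hg : ∀ d, 0 ≤ z (d + 1) - z d := fun d => sub_nonneg.2 (hz d.le_succ)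
  rcases A.eq_empty_or_nonempty with rfl | ⟨d, hd⟩
  · simpa using sq_nonneg _
  · have hab : a ≤ b := ((hA d hd).1.trans (hz d.le_succ)).trans (hA d hd).2
    exact (sum_sq_le_sq_sum_of_nonneg fun i _ => hg i).trans
      (pow_le_pow_left₀ (sum_nonneg fun i _ => hg i) (sum_gap_le hz A hab hA) 2)

/-- A discrete Poincaré inequality: mean zero turns the sum of squares into pairwise differences,
and each difference telescopes into at most `N` gaps, to which Cauchy–Schwarz applies. -/
lemma sum_sq_le_mul_sum_gap_sq {N : ℕ} {x : Fin N → ℝ} (hx : ∑ i, x i = 0) {z : ℕ → ℝ}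
    {r : Fin N → ℕ} (hr : ∀ i, r i < N) (hxz : ∀ i, x i = z (r i)) :
    ∑ i, x i ^ 2 ≤ (N : ℝ) ^ 2 * ∑ d ∈ range (N - 1), (z (d + 1) - z d) ^ 2 := by
  set g := ∑ d ∈ range (N - 1), (z (d + 1) - z d) ^ 2
  have hg : 0 ≤ g := sum_nonneg fun _ _ => sq_nonneg _
  have key : ∀ i j, r i ≤ r j → (x i - x j) ^ 2 ≤ N * g := by
    intro i j hij
    have h1 : x j - x i = ∑ d ∈ Ico (r i) (r j), (z (d + 1) - z d) := by
      rw [hxz, hxz, Finset.sum_Ico_sub z hij]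
    have h2 : (x i - x j) ^ 2 = (∑ d ∈ Ico (r i) (r j), (z (d + 1) - z d)) ^ 2 := by
      rw [← h1]; ring
    rw [h2]
    refine sq_sum_le_card_mul_sum_sq.trans ?_
    have h3 : ((Ico (r i) (r j)).card : ℝ) ≤ N := by
      rw [Nat.card_Ico]
      exact_mod_cast (Nat.sub_le _ _).trans (hr j).le
    refine mul_le_mul h3 (sum_le_sum_of_subset_of_nonneg ?_ fun _ _ _ => sq_nonneg _)
      (sum_nonneg fun _ _ => sq_nonneg _) (Nat.cast_nonneg _)
    intro d hd
    have := hr j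
    simp only [mem_Ico, mem_range] at hd ⊢
    omega
  have key' : ∀ i j, (x i - x j) ^ 2 ≤ N * g := by
    intro i j
    rcases le_total (r i) (r j) with h | h
    · exact key i j h
    · have := key j i h
      rwa [← neg_sub, neg_sq] at this
  rcases N.eq_zero_or_pos with rfl | hN
  · simp
  have hN' : (0 : ℝ) < N := by exact_mod_cast hN
  have h1 : ∑ i, ∑ j, (x i - x j) ^ 2 = 2 * N * ∑ i, x i ^ 2 := by
    have h : ∀ i j, (x i - x j) ^ 2 = x i ^ 2 + x j ^ 2 - 2 * (x i * x j) := by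
      intro i j; ring
    simp_rw [h, sum_sub_distrib, sum_add_distrib, ← mul_sum, hx]
    simp [← mul_sum]
    ring
  have h2 : ∑ i, ∑ j, (x i - x j) ^ 2 ≤ N * (N * (N * g)) := by
    refine (sum_le_sum fun i _ => sum_le_sum fun j _ => key' i j).trans ?_
    simp
  rw [h1] at h2
  have h3 : N * ∑ i, x i ^ 2 ≤ N * (N ^ 2 * g) := by
    have : 0 ≤ N * ∑ i, x i ^ 2 := mul_nonneg hN'.le (sum_nonneg fun _ _ => sq_nonneg _)
    nlinarith
  exact le_of_mul_le_mul_left h3 hN'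

/-! ### Contraction over a jointly connected window -/

/-- Superposition of cuts. For the values `x i` and `x j`, the gaps of `C` separating them are
disjoint subintervals between them, so `(x i - x j) ^ 2` dominates the sum of the squared gaps times
the squared differences of the cut indicators. The decrease is a nonnegative combination of such
squares, hence dominates the weighted decreases of the cuts. The gaps may come from an earlier
vector, as long as `x` still leaves them empty. -/
lemma sum_gap_sq_le_sum_sq_sub {N : ℕ} {P : Matrix (Fin N) (Fin N) ℝ}
    (hP : P ∈ doublyStochastic ℝ (Fin N)) {η : ℝ} {x : Fin N → ℝ} {z : ℕ → ℝ}
    (hz : Monotone z) (r : Fin N → ℕ) (C : Finset ℕ)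
    (hup : ∀ d ∈ C, ∀ i, d < r i → z (d + 1) ≤ x i)
    (hlo : ∀ d ∈ C, ∀ i, ¬ d < r i → x i ≤ z d)
    (hC : ∀ d ∈ C, ∃ k l, η ≤ P k k ∧ η ≤ P k l ∧ (d < r k ↔ ¬ d < r l)) :
    η / 2 * ∑ d ∈ C, (z (d + 1) - z d) ^ 2 ≤ ∑ i, x i ^ 2 - ∑ k, (P *ᵥ x) k ^ 2 := by
  have hnn := (mem_doublyStochastic_iff_sum.1 hP).1
  let χ : ℕ → Fin N → ℝ := fun d i => if d < r i then 1 else 0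
  have pair_aux : ∀ i j, r i ≤ r j →
      ∑ d ∈ C, (z (d + 1) - z d) ^ 2 * (χ d i - χ d j) ^ 2 ≤ (x i - x j) ^ 2 := by
    intro i j hij
    have h1 : ∀ d, (z (d + 1) - z d) ^ 2 * (χ d i - χ d j) ^ 2 =
        if ¬ d < r i ∧ d < r j then (z (d + 1) - z d) ^ 2 else 0 := by
      intro d
      by_cases h1 : d < r i
      · simp [χ, h1, h1.trans_le hij]
      · by_cases h2 : d < r j <;> simp [χ, h1, h2]
    simp_rw [h1]
    rw [← sum_filter, ← neg_sub (x j), neg_sq]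
    refine sum_gap_sq_le hz _ fun d hd => ?_
    rw [mem_filter] at hd
    exact ⟨hlo d hd.1 i hd.2.1, hup d hd.1 j hd.2.2⟩
  have pair : ∀ i j,
      ∑ d ∈ C, (z (d + 1) - z d) ^ 2 * (χ d i - χ d j) ^ 2 ≤ (x i - x j) ^ 2 := by
    intro i j
    rcases le_total (r i) (r j) with h | h
    · exact pair_aux i j h
    · have := pair_aux j i h
      rw [← neg_sub (x i), neg_sq] at this
      refine le_trans (le_of_eq (sum_congr rfl fun d _ => ?_)) this
      ring
  calc η / 2 * ∑ d ∈ C, (z (d + 1) - z d) ^ 2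
      ≤ ∑ d ∈ C, (z (d + 1) - z d) ^ 2 * (∑ i, χ d i ^ 2 - ∑ k, (P *ᵥ χ d) k ^ 2) := by
        rw [mul_sum]
        refine sum_le_sum fun d hd => ?_
        obtain ⟨k, l, hk, hl, hkl⟩ := hC d hd
        rw [mul_comm]
        exact mul_le_mul_of_nonneg_left
          (half_le_sum_sq_sub_of_cut hP (fun i => d < r i) hk hl hkl) (sq_nonneg _)
    _ = ∑ k, (1 / 2) * ∑ i, ∑ j, P k i * P k j *
          ∑ d ∈ C, (z (d + 1) - z d) ^ 2 * (χ d i - χ d j) ^ 2 := by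
        simp_rw [sum_sq_sub_sum_sq_mulVec hP, mul_sum]
        rw [sum_comm]
        refine sum_congr rfl fun k _ => ?_
        rw [sum_comm]
        refine sum_congr rfl fun i _ => ?_
        rw [sum_comm]
        refine sum_congr rfl fun j _ => sum_congr rfl fun d _ => ?_
        ring
    _ ≤ ∑ i, x i ^ 2 - ∑ k, (P *ᵥ x) k ^ 2 := by
        rw [sum_sq_sub_sum_sq_mulVec hP]
        refine sum_le_sum fun k _ => mul_le_mul_of_nonneg_left ?_ (by norm_num)
        exact sum_le_sum fun i _ => sum_le_sum fun j _ =>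
          mul_le_mul_of_nonneg_left (pair i j) (mul_nonneg (hnn _ _) (hnn _ _))

/-- Doubly stochastic, with all positive entries and all diagonal entries at least `η`. -/
structure IsAveraging {N : ℕ} (η : ℝ) (P : Matrix (Fin N) (Fin N) ℝ) : Prop where
  mem : P ∈ doublyStochastic ℝ (Fin N)
  diag : ∀ i, η ≤ P i i
  entry : ∀ i j, P i j ≠ 0 → η ≤ P i j

lemma le_mulVec_of_forall {N : ℕ} {P : Matrix (Fin N) (Fin N) ℝ}
    (hP : P ∈ doublyStochastic ℝ (Fin N)) {x : Fin N → ℝ} {c : ℝ} {i : Fin N}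
    (h : ∀ j, P i j ≠ 0 → c ≤ x j) : c ≤ (P *ᵥ x) i := by
  obtain ⟨hnn, hrow, -⟩ := mem_doublyStochastic_iff_sum.1 hP
  calc c = ∑ j, P i j * c := by rw [← sum_mul, hrow, one_mul]
    _ ≤ ∑ j, P i j * x j := by
      refine sum_le_sum fun j _ => ?_
      by_cases hj : P i j = 0
      · simp [hj]
      · exact mul_le_mul_of_nonneg_left (h j hj) (hnn _ _)

lemma mulVec_le_of_forall {N : ℕ} {P : Matrix (Fin N) (Fin N) ℝ}
    (hP : P ∈ doublyStochastic ℝ (Fin N)) {x : Fin N → ℝ} {c : ℝ} {i : Fin N}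
    (h : ∀ j, P i j ≠ 0 → x j ≤ c) : (P *ᵥ x) i ≤ c := by
  have := le_mulVec_of_forall hP (x := -x) (c := -c) (i := i) fun j hj => neg_le_neg (h j hj)
  rw [mulVec_neg] at this
  simpa using this

lemma exists_sorting {N : ℕ} (y : Fin N → ℝ) :
    ∃ (z : ℕ → ℝ) (r : Fin N → ℕ), Monotone z ∧ (∀ i, r i < N) ∧ (∀ i, y i = z (r i)) ∧
      ∀ d < N, ∃ i, r i = d := by
  rcases N.eq_zero_or_pos with rfl | hN
  · exact ⟨fun _ => 0, fun i => 0, monotone_const, fun i => i.elim0, fun i => i.elim0,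
      fun d hd => absurd hd (Nat.not_lt_zero d)⟩
  let π := Tuple.sort y
  -- Capping the index at `N - 1` repeats the largest value, so that `z` is monotone on all of `ℕ`.
  refine ⟨fun d => y (π ⟨min d (N - 1), by omega⟩), fun i => (π.symm i : ℕ), ?_,
    fun i => (π.symm i).2, fun i => ?_, fun d hd => ⟨π ⟨d, hd⟩, by simp⟩⟩
  · intro a b hab
    refine Tuple.monotone_sort y ?_
    rw [Fin.mk_le_mk]
    omega
  · have h : (⟨min (π.symm i : ℕ) (N - 1), by omega⟩ : Fin N) = π.symm i := by
      ext
      have := (π.symm i).2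
      simp only
      omega
    simp only [h, Equiv.apply_symm_apply]

/-- Each gap of the initial vector is charged to the first time `τ d` at which a nonzero entry joins
its two sides. Until then the gap stays empty, so its full initial size counts. -/
lemma sum_sq_window_le {N B : ℕ} {η : ℝ} (hη : 0 ≤ η) {P : ℕ → Matrix (Fin N) (Fin N) ℝ}
    (hP : ∀ t < B, IsAveraging η (P t))
    (hconn : ∀ U : Fin N → Prop, (∃ i, U i) → (∃ j, ¬ U j) →
      ∃ t < B, ∃ i j, U i ∧ ¬ U j ∧ P t i j ≠ 0)
    {x : ℕ → Fin N → ℝ} (hx : ∀ t < B, x (t + 1) = P t *ᵥ x t) (hx0 : ∑ i, x 0 i = 0) :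
    ∑ i, x B i ^ 2 ≤ (1 - η / (2 * (N : ℝ) ^ 2)) * ∑ i, x 0 i ^ 2 := by
  classical
  rcases N.eq_zero_or_pos with rfl | hN
  · simp
  obtain ⟨z, r, hz, hr, hxz, hsurj⟩ := exists_sorting (x 0)
  let Cross : ℕ → ℕ → Prop := fun d t => t < B ∧ ∃ k l, P t k l ≠ 0 ∧ (d < r k ↔ ¬ d < r l)
  -- Membership is a premise inside the existential so that `choose` yields a `τ` defined on all of
  -- `ℕ`; outside the range its value 0 is a dummy.
  have hfirst : ∀ d, ∃ t, d ∈ range (N - 1) → Cross d t ∧ ∀ s < t, ¬ Cross d s := by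
    intro d
    by_cases hd : d ∈ range (N - 1)
    · rw [mem_range] at hd
      obtain ⟨i, hi⟩ := hsurj (d + 1) (by omega)
      obtain ⟨j, hj⟩ := hsurj d (by omega)
      obtain ⟨t, ht, k, l, hk, hl, hkl⟩ := hconn (fun i => d < r i) ⟨i, by omega⟩ ⟨j, by omega⟩
      have hex : ∃ t, Cross d t := ⟨t, ht, k, l, hkl, by simp [hk, hl]⟩
      exact ⟨Nat.find hex, fun _ => ⟨Nat.find_spec hex, fun s hs => Nat.find_min hex hs⟩⟩
    · exact ⟨0, fun h => absurd h hd⟩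
  choose τ hτ using hfirst
  -- Before time `τ d` every row averages values from one side of the cut only, so neither side
  -- enters the gap.
  have hside : ∀ d ∈ range (N - 1), ∀ t ≤ τ d,
      (∀ i, d < r i → z (d + 1) ≤ x t i) ∧ (∀ i, ¬ d < r i → x t i ≤ z d) := by
    intro d hd t
    induction t with
    | zero =>
      refine fun _ => ⟨fun i hi => ?_, fun i hi => ?_⟩
      · rw [hxz]; exact hz hi
      · rw [hxz]; exact hz (not_lt.1 hi)
    | succ t ih =>
      intro ht
      obtain ⟨h1, h2⟩ := ih (by omega)
      have htB : t < B := lt_trans ht (hτ d hd).1.1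
      have hnc : ∀ k l, P t k l ≠ 0 → ¬ (d < r k ↔ ¬ d < r l) := fun k l hkl hU =>
        (hτ d hd).2 t ht ⟨htB, k, l, hkl, hU⟩
      rw [hx t htB]
      refine ⟨fun i hi => le_mulVec_of_forall (hP t htB).mem fun j hj => h1 j ?_,
        fun i hi => mulVec_le_of_forall (hP t htB).mem fun j hj => h2 j ?_⟩
      · have := hnc i j hj; tauto
      · have := hnc i j hj; tauto
  have hstep : ∀ t ∈ range B, η / 2 * ∑ d ∈ (range (N - 1)).filter (fun d => τ d = t),
      (z (d + 1) - z d) ^ 2 ≤ ∑ i, x t i ^ 2 - ∑ i, x (t + 1) i ^ 2 := by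
    intro t ht
    rw [mem_range] at ht
    rw [hx t ht]
    refine sum_gap_sq_le_sum_sq_sub (hP t ht).mem hz r _ (fun d hd => ?_) (fun d hd => ?_)
      fun d hd => ?_
    all_goals
      rw [mem_filter] at hd
    · exact (hside d hd.1 t hd.2.ge).1
    · exact (hside d hd.1 t hd.2.ge).2
    · obtain ⟨-, k, l, hkl, hU⟩ := (hτ d hd.1).1
      rw [hd.2] at hkl
      exact ⟨k, l, (hP t ht).diag k, (hP t ht).entry k l hkl, hU⟩
  -- The decreases telescope over the window, and every gap belongs to exactly one fibre of `τ`.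
  have hsum := sum_le_sum hstep
  rw [← mul_sum, sum_fiberwise_of_maps_to (fun d hd => mem_range.2 (hτ d hd).1.1),
    sum_range_sub' (fun t => ∑ i, x t i ^ 2)] at hsum
  have hpoin := sum_sq_le_mul_sum_gap_sq hx0 hr hxz
  have hN' : (0 : ℝ) < (N : ℝ) ^ 2 := by positivity
  have h : η / (2 * (N : ℝ) ^ 2) * ∑ i, x 0 i ^ 2 ≤
      η / 2 * ∑ d ∈ range (N - 1), (z (d + 1) - z d) ^ 2 := by
    calc _ ≤ η / (2 * (N : ℝ) ^ 2) * (N ^ 2 * ∑ d ∈ range (N - 1), (z (d + 1) - z d) ^ 2) :=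
          mul_le_mul_of_nonneg_left hpoin (by positivity)
      _ = _ := by field_simp
  linarith

/-! ### Block action on stacked vectors -/

section Stack

variable {N d : ℕ}

@[simp] lemma blockAct_apply (A : Matrix (Fin N) (Fin N) ℝ) (x : Stack N d) (i : Fin N) :
    blockAct A x i = ∑ j, A i j • x j := rfl

@[simp] lemma agree_apply (y : EuclideanSpace ℝ (Fin d)) (i : Fin N) : agree N y i = y := rfl

lemma blockAct_add (A : Matrix (Fin N) (Fin N) ℝ) (x y : Stack N d) :
    blockAct A (x + y) = blockAct A x + blockAct A y := by
  ext1 i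
  simp [smul_add, sum_add_distrib]

lemma blockAct_sub (A : Matrix (Fin N) (Fin N) ℝ) (x y : Stack N d) :
    blockAct A (x - y) = blockAct A x - blockAct A y := by
  ext1 i
  simp [smul_sub, sum_sub_distrib]

lemma blockAct_one_sub_smul (σ : ℝ) (L : Matrix (Fin N) (Fin N) ℝ) (x : Stack N d) :
    blockAct (1 - σ • L) x = x - σ • blockAct L x := by
  ext1 i
  simp [sub_smul, sum_sub_distrib, Matrix.one_apply, ite_smul, smul_sum, mul_smul]

lemma coord_blockAct (A : Matrix (Fin N) (Fin N) ℝ) (x : Stack N d) (c : Fin d) :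
    (fun i => blockAct A x i c) = A *ᵥ fun i => x i c := by
  ext i
  simp [Matrix.mulVec, dotProduct]

lemma norm_sq_eq_sum_coord (x : Stack N d) : ‖x‖ ^ 2 = ∑ c, ∑ i, x i c ^ 2 := by
  rw [PiLp.norm_sq_eq_of_L2, sum_comm]
  simp [EuclideanSpace.norm_sq_eq]

lemma norm_blockAct_le {P : Matrix (Fin N) (Fin N) ℝ} (hP : P ∈ doublyStochastic ℝ (Fin N))
    (x : Stack N d) : ‖blockAct P x‖ ≤ ‖x‖ := by
  rw [← abs_norm, ← abs_norm x, ← sq_le_sq, norm_sq_eq_sum_coord, norm_sq_eq_sum_coord]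
  refine sum_le_sum fun c _ => ?_
  have := sum_sq_mulVec_le hP fun i => x i c
  rwa [← coord_blockAct] at this

lemma blockAct_agree {P : Matrix (Fin N) (Fin N) ℝ} (hP : P ∈ doublyStochastic ℝ (Fin N))
    (y : EuclideanSpace ℝ (Fin d)) : blockAct P (agree N y) = agree N y := by
  ext1 i
  simp only [blockAct_apply, agree_apply]
  rw [← sum_smul, sum_row_of_mem_doublyStochastic hP, one_smul]

lemma sum_blockAct {P : Matrix (Fin N) (Fin N) ℝ} (hP : P ∈ doublyStochastic ℝ (Fin N))
    (x : Stack N d) : ∑ i, blockAct P x i = ∑ i, x i := by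
  simp only [blockAct_apply]
  rw [sum_comm]
  refine sum_congr rfl fun j _ => ?_
  rw [← sum_smul, sum_col_of_mem_doublyStochastic hP, one_smul]

/-- The average of the blocks. -/
noncomputable def blockMean (x : Stack N d) : EuclideanSpace ℝ (Fin d) := (N : ℝ)⁻¹ • ∑ i, x i

/-- The deviation of a stacked vector from agreement. -/
noncomputable def disagreement (x : Stack N d) : Stack N d := x - agree N (blockMean x)

lemma blockMean_agree (hN : N ≠ 0) (y : EuclideanSpace ℝ (Fin d)) :
    blockMean (agree N y) = y := by
  have : (N : ℝ) ≠ 0 := Nat.cast_ne_zero.2 hN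
  simp [blockMean, ← Nat.cast_smul_eq_nsmul ℝ, smul_smul, this]

lemma disagreement_agree (hN : N ≠ 0) (y : EuclideanSpace ℝ (Fin d)) :
    disagreement (agree N y) = 0 := by
  rw [disagreement, blockMean_agree hN, sub_self]

lemma disagreement_add (x y : Stack N d) :
    disagreement (x + y) = disagreement x + disagreement y := by
  ext1 i
  simp [disagreement, blockMean, sum_add_distrib, smul_add]
  abel

lemma disagreement_smul (c : ℝ) (x : Stack N d) :
    disagreement (c • x) = c • disagreement x := by
  ext1 i
  simp [disagreement, blockMean, ← smul_sum, smul_sub, smul_comm c]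

lemma disagreement_sum {ι : Type*} (s : Finset ι) (x : ι → Stack N d) :
    disagreement (∑ t ∈ s, x t) = ∑ t ∈ s, disagreement (x t) := by
  classical
  induction s using Finset.induction_on with
  | empty => simpa using disagreement_smul 0 (0 : Stack N d)
  | insert a s ha ih => rw [sum_insert ha, sum_insert ha, disagreement_add, ih]

lemma sum_disagreement (hN : N ≠ 0) (x : Stack N d) : ∑ i, disagreement x i = 0 := by
  have : (N : ℝ) ≠ 0 := Nat.cast_ne_zero.2 hN
  simp [disagreement, blockMean, sum_sub_distrib, ← Nat.cast_smul_eq_nsmul ℝ, smul_smul, this]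

lemma disagreement_blockAct {P : Matrix (Fin N) (Fin N) ℝ}
    (hP : P ∈ doublyStochastic ℝ (Fin N)) (x : Stack N d) :
    disagreement (blockAct P x) = blockAct P (disagreement x) := by
  rw [disagreement, disagreement, blockAct_sub, blockAct_agree hP, blockMean, blockMean,
    sum_blockAct hP]

lemma inner_disagreement_agree (hN : N ≠ 0) (x : Stack N d) (y : EuclideanSpace ℝ (Fin d)) :
    inner ℝ (disagreement x) (agree N y) = 0 := by
  rw [PiLp.inner_apply]
  simp only [agree_apply]
  rw [← sum_inner, sum_disagreement hN, inner_zero_left]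

lemma norm_sq_eq_add_disagreement (hN : N ≠ 0) (x : Stack N d) :
    ‖x‖ ^ 2 = ‖disagreement x‖ ^ 2 + ‖agree N (blockMean x)‖ ^ 2 := by
  have h := norm_add_sq_real (disagreement x) (agree N (blockMean x))
  rw [inner_disagreement_agree hN] at h
  rw [disagreement, sub_add_cancel] at h
  rw [h, disagreement]
  ring

lemma norm_disagreement_le (hN : N ≠ 0) (x : Stack N d) : ‖disagreement x‖ ≤ ‖x‖ := by
  rw [← abs_norm, ← abs_norm x, ← sq_le_sq, norm_sq_eq_add_disagreement hN x]
  exact le_add_of_nonneg_right (sq_nonneg _)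

lemma norm_agree_blockMean_le (hN : N ≠ 0) (x : Stack N d) : ‖agree N (blockMean x)‖ ≤ ‖x‖ := by
  rw [← abs_norm, ← abs_norm x, ← sq_le_sq, norm_sq_eq_add_disagreement hN x]
  exact le_add_of_nonneg_left (sq_nonneg _)

/-- Averaging fixes the agreed part, so only the disagreement moves. -/
lemma norm_sub_blockAct_le {P : Matrix (Fin N) (Fin N) ℝ}
    (hP : P ∈ doublyStochastic ℝ (Fin N)) (x : Stack N d) :
    ‖x - blockAct P x‖ ≤ 2 * ‖disagreement x‖ := by
  have h : x - blockAct P x = disagreement x - blockAct P (disagreement x) := by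
    rw [disagreement, blockAct_sub, blockAct_agree hP]
    abel
  rw [h]
  have := norm_blockAct_le hP (disagreement x)
  linarith [norm_sub_le (disagreement x) (blockAct P (disagreement x))]

lemma convex_stackSet {S : Set (EuclideanSpace ℝ (Fin d))} (hS : Convex ℝ S) :
    Convex ℝ (stackSet N S) := by
  intro x hx y hy a b ha hb hab i
  exact hS (hx i) (hy i) ha hb hab

lemma blockAct_mem_stackSet {S : Set (EuclideanSpace ℝ (Fin d))} (hS : Convex ℝ S)
    {P : Matrix (Fin N) (Fin N) ℝ} (hP : P ∈ doublyStochastic ℝ (Fin N)) {x : Stack N d}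
    (hx : x ∈ stackSet N S) : blockAct P x ∈ stackSet N S := fun i =>
  hS.sum_mem (fun _ _ => nonneg_of_mem_doublyStochastic hP)
    (sum_row_of_mem_doublyStochastic hP i) fun j _ => hx j

lemma blockMean_mem (hN : N ≠ 0) {S : Set (EuclideanSpace ℝ (Fin d))} (hS : Convex ℝ S)
    {x : Stack N d} (hx : x ∈ stackSet N S) : blockMean x ∈ S := by
  have : (N : ℝ) ≠ 0 := Nat.cast_ne_zero.2 hN
  rw [blockMean, smul_sum]
  exact hS.sum_mem (fun _ _ => by positivity) (by simp [this]) fun j _ => hx j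

/-! ### Decay of the disagreement -/

/-- The state after `n` consensus steps, starting from `x` at time `s`. -/
noncomputable def evolve (P : ℕ → Matrix (Fin N) (Fin N) ℝ) (s : ℕ) : ℕ → Stack N d → Stack N d
  | 0, x => x
  | n + 1, x => blockAct (P (s + n)) (evolve P s n x)

lemma evolve_add (P : ℕ → Matrix (Fin N) (Fin N) ℝ) (s m n : ℕ) (x : Stack N d) :
    evolve P s (m + n) x = evolve P (s + m) n (evolve P s m x) := by
  induction n with
  | zero => rfl
  | succ n ih => rw [← add_assoc, evolve, evolve, ih, add_assoc]

lemma evolve_succ' (P : ℕ → Matrix (Fin N) (Fin N) ℝ) (s n : ℕ) (x : Stack N d) :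
    evolve P s (n + 1) x = evolve P (s + 1) n (blockAct (P s) x) := by
  rw [add_comm, evolve_add]
  rfl

lemma evolve_vadd (P : ℕ → Matrix (Fin N) (Fin N) ℝ) (s n : ℕ) (x y : Stack N d) :
    evolve P s n (x + y) = evolve P s n x + evolve P s n y := by
  induction n with
  | zero => rfl
  | succ n ih => rw [evolve, evolve, evolve, ih, blockAct_add]

/-- Averaging matrices at the times `t ≥ 1`, jointly connected over the windows
`[kB, (k+1)B)`, `k ≥ 1`. -/
structure IsConsensus (B : ℕ) (η : ℝ) (P : ℕ → Matrix (Fin N) (Fin N) ℝ) : Prop where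
  averaging : ∀ t, 1 ≤ t → IsAveraging η (P t)
  connected : ∀ k, 1 ≤ k → ∀ U : Fin N → Prop, (∃ i, U i) → (∃ j, ¬ U j) →
    ∃ t < B, ∃ i j, U i ∧ ¬ U j ∧ P (k * B + t) i j ≠ 0

variable {B : ℕ} {η : ℝ} {P : ℕ → Matrix (Fin N) (Fin N) ℝ}

lemma norm_evolve_le (hP : ∀ t, 1 ≤ t → P t ∈ doublyStochastic ℝ (Fin N)) {s : ℕ} (hs : 1 ≤ s)
    (n : ℕ) (x : Stack N d) : ‖evolve P s n x‖ ≤ ‖x‖ := by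
  induction n with
  | zero => rfl
  | succ n ih => exact (norm_blockAct_le (hP _ (by omega)) _).trans ih

lemma sum_evolve (hP : ∀ t, 1 ≤ t → P t ∈ doublyStochastic ℝ (Fin N)) {s : ℕ} (hs : 1 ≤ s)
    (n : ℕ) (x : Stack N d) : ∑ i, evolve P s n x i = ∑ i, x i := by
  induction n with
  | zero => rfl
  | succ n ih => rw [evolve, sum_blockAct (hP _ (by omega)), ih]

lemma IsConsensus.norm_window_le (h : IsConsensus B η P) (hB : 1 ≤ B) (hη : 0 ≤ η) (hη1 : η ≤ 1)
    (hN : N ≠ 0) {k : ℕ} (hk : 1 ≤ k) {x : Stack N d} (hx : ∑ i, x i = 0) :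
    ‖evolve P (k * B) B x‖ ≤ (1 - η / (4 * (N : ℝ) ^ 2)) * ‖x‖ := by
  have hkB : 1 ≤ k * B := Nat.mul_pos hk hB
  have hN' : (1 : ℝ) ≤ (N : ℝ) ^ 2 := one_le_pow₀ (by exact_mod_cast Nat.pos_of_ne_zero hN)
  have hq : η / (4 * (N : ℝ) ^ 2) ≤ 1 := by
    rw [div_le_one (by positivity)]
    linarith
  have hρ : 0 ≤ (1 - η / (4 * (N : ℝ) ^ 2)) * ‖x‖ :=
    mul_nonneg (by linarith) (norm_nonneg _)
  refine le_of_sq_le_sq ?_ hρ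
  rw [mul_pow, norm_sq_eq_sum_coord, norm_sq_eq_sum_coord, mul_sum]
  refine sum_le_sum fun c _ => ?_
  have hw := sum_sq_window_le hη (P := fun t => P (k * B + t))
    (fun t _ => h.averaging _ (by omega)) (h.connected k hk)
    (x := fun t i => evolve P (k * B) t x i c)
    (fun t _ => coord_blockAct _ _ _) (by
      have := congrArg (fun v : EuclideanSpace ℝ (Fin d) => v c) hx
      simpa [evolve] using this)
  refine hw.trans (mul_le_mul_of_nonneg_right ?_ (sum_nonneg fun _ _ => sq_nonneg _))
  -- With `a = η / (4 * N ^ 2)`, the contraction of squares passes to norms by `1 - 2 * a ≤ (1 - a)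
  -- ^ 2`.
  have : η / (2 * (N : ℝ) ^ 2) = 2 * (η / (4 * (N : ℝ) ^ 2)) := by field_simp; norm_num
  rw [this]
  nlinarith [sq_nonneg (η / (4 * (N : ℝ) ^ 2))]

lemma IsConsensus.norm_windows_le (h : IsConsensus B η P) (hB : 1 ≤ B) (hη : 0 ≤ η)
    (hη1 : η ≤ 1) (hN : N ≠ 0) {k : ℕ} (hk : 1 ≤ k) {x : Stack N d} (hx : ∑ i, x i = 0) (m : ℕ) :
    ‖evolve P (k * B) (m * B) x‖ ≤ (1 - η / (4 * (N : ℝ) ^ 2)) ^ m * ‖x‖ := by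
  have hP : ∀ t, 1 ≤ t → P t ∈ doublyStochastic ℝ (Fin N) := fun t ht => (h.averaging t ht).mem
  have hkB : 1 ≤ k * B := Nat.mul_pos hk hB
  have hρ : 0 ≤ 1 - η / (4 * (N : ℝ) ^ 2) := by
    have hN' : (1 : ℝ) ≤ (N : ℝ) ^ 2 := one_le_pow₀ (by exact_mod_cast Nat.pos_of_ne_zero hN)
    rw [sub_nonneg, div_le_one (by positivity)]
    linarith
  induction m with
  | zero => simp [evolve]
  | succ m ih =>
    rw [Nat.succ_mul, evolve_add, ← Nat.add_mul, pow_succ', mul_assoc]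
    exact (h.norm_window_le hB hη hη1 hN (by omega) (by rw [sum_evolve hP hkB, hx])).trans
      (mul_le_mul_of_nonneg_left ih hρ)

/-- The interval need not be aligned with the windows: at most `B` steps at the start and fewer than
`B` at the end are wasted. This costs at most `q ^ (2 * B) = ρ ^ 2 ≥ (3 / 4) ^ 2`, which explains
the factor 16/9. -/
lemma IsConsensus.norm_evolve_le_geometric (h : IsConsensus B η P) (hB : 1 ≤ B) (hη : 0 ≤ η)
    (hη1 : η ≤ 1) (hN : N ≠ 0) {s : ℕ} (hs : 1 ≤ s) {x : Stack N d} (hx : ∑ i, x i = 0) (n : ℕ) :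
    ‖evolve P s n x‖ ≤
      16 / 9 * ((1 - η / (4 * (N : ℝ) ^ 2)) ^ (1 / (B : ℝ))) ^ n * ‖x‖ := by
  have hP : ∀ t, 1 ≤ t → P t ∈ doublyStochastic ℝ (Fin N) := fun t ht => (h.averaging t ht).mem
  have hN' : (1 : ℝ) ≤ (N : ℝ) ^ 2 := one_le_pow₀ (by exact_mod_cast Nat.pos_of_ne_zero hN)
  have hBr : (B : ℝ) ≠ 0 := Nat.cast_ne_zero.2 (by omega)
  have hq4 : η / (4 * (N : ℝ) ^ 2) ≤ 1 / 4 := by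
    rw [div_le_div_iff₀ (by positivity) (by norm_num)]
    nlinarith
  have hq0 : 0 ≤ η / (4 * (N : ℝ) ^ 2) := by positivity
  set ρ := 1 - η / (4 * (N : ℝ) ^ 2) with hρdef
  have hρ : 3 / 4 ≤ ρ := by linarith
  have hρ1 : ρ ≤ 1 := by linarith
  set q := ρ ^ (1 / (B : ℝ)) with hqdef
  have hq : 0 ≤ q := Real.rpow_nonneg (by linarith) _
  have hq1 : q ≤ 1 := Real.rpow_le_one (by linarith) hρ1 (by positivity)
  have hqB : q ^ B = ρ := by
    rw [hqdef, ← Real.rpow_natCast, ← Real.rpow_mul (by linarith), one_div_mul_cancel hBr,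
      Real.rpow_one]
  have hq2 : ∀ l ≤ 2 * B, 9 / 16 ≤ q ^ l := by
    intro l hl
    calc (9 / 16 : ℝ) ≤ ρ ^ 2 := by nlinarith
      _ = q ^ (2 * B) := by rw [mul_comm, pow_mul, hqB]
      _ ≤ q ^ l := pow_le_pow_of_le_one hq hq1 hl
  -- The next window starts strictly after `s`, which ensures `1 ≤ k`; connectivity is only
  -- available from there.
  obtain ⟨k, n₀, hk, hn₀, hkn⟩ : ∃ k n₀, 1 ≤ k ∧ n₀ ≤ B ∧ s + n₀ = k * B := by
    refine ⟨s / B + 1, B - s % B, Nat.le_add_left _ _, Nat.sub_le _ _, ?_⟩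
    have h1 := Nat.div_add_mod s B
    have h2 := Nat.mod_lt s hB
    rw [add_mul, mul_comm (s / B) B]
    omega
  rcases le_total n n₀ with hn | hn
  · refine (norm_evolve_le hP hs n x).trans ?_
    nlinarith [hq2 n (by omega), norm_nonneg x]
  · obtain ⟨l, rfl⟩ := Nat.exists_eq_add_of_le hn
    obtain ⟨a, b, hb, rfl⟩ : ∃ a b, b < B ∧ l = a * B + b :=
      ⟨l / B, l % B, Nat.mod_lt l hB, (Nat.div_add_mod' l B).symm⟩
    have hsum : ∑ i, evolve P s n₀ x i = 0 := by rw [sum_evolve hP hs, hx]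
    have h1 : ‖evolve P s (n₀ + (a * B + b)) x‖ ≤ ρ ^ a * ‖x‖ := by
      rw [evolve_add, hkn, evolve_add]
      refine (norm_evolve_le hP ((Nat.mul_pos hk hB).trans_le (Nat.le_add_right _ _)) _ _).trans ?_
      refine (h.norm_windows_le hB hη hη1 hN hk hsum _).trans ?_
      exact mul_le_mul_of_nonneg_left (norm_evolve_le hP hs _ _) (pow_nonneg (by linarith) _)
    refine h1.trans (mul_le_mul_of_nonneg_right ?_ (norm_nonneg _))
    have h2 : q ^ (n₀ + (a * B + b)) = q ^ (n₀ + b) * ρ ^ a := by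
      rw [← hqB, ← pow_mul, ← pow_add]
      congr 1
      ring
    rw [h2]
    nlinarith [hq2 (n₀ + b) (by omega), pow_nonneg (show 0 ≤ ρ by linarith) a]

/-- The accumulated disagreement of perturbed consensus dynamics is controlled by the initial
state and the accumulated perturbations. -/
lemma sum_norm_disagreement_le (hN : N ≠ 0)
    (hP : ∀ t, 1 ≤ t → P t ∈ doublyStochastic ℝ (Fin N)) {K q : ℝ} (hK0 : 0 ≤ K)
    (hq : 0 ≤ q) (hq1 : q < 1)
    (hdecay : ∀ s, 1 ≤ s → ∀ x : Stack N d, ∑ i, x i = 0 →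
      ∀ n, ‖evolve P s n x‖ ≤ K * q ^ n * ‖x‖)
    {x u : ℕ → Stack N d} (hx : ∀ t, 1 ≤ t → x (t + 1) = blockAct (P t) (x t) + u t) (T : ℕ) :
    ∑ t ∈ Ico 1 (T + 1), ‖disagreement (x t)‖ ≤
      K / (1 - q) * (‖x 1‖ + ∑ t ∈ Ico 1 (T + 1), ‖u t‖) := by
  have hgeom : ∀ x : Stack N d, HasSum (fun n => K * q ^ n * ‖x‖) (K / (1 - q) * ‖x‖) :=
    fun x => ((hasSum_geometric_of_lt_one hq hq1).mul_left K).mul_right ‖x‖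
  have hsm : ∀ s, 1 ≤ s → ∀ x : Stack N d, ∑ i, x i = 0 →
      Summable fun n => ‖evolve P s n x‖ := fun s hs x hx =>
    Summable.of_nonneg_of_le (fun _ => norm_nonneg _) (hdecay s hs x hx) (hgeom x).summable
  have hpot : ∀ s, 1 ≤ s → ∀ x : Stack N d, ∑ i, x i = 0 →
      ∑' n, ‖evolve P s n x‖ ≤ K / (1 - q) * ‖x‖ := fun s hs x hx =>
    (hgeom x).tsum_eq ▸ (hsm s hs x hx).tsum_le_tsum (hdecay s hs x hx) (hgeom x).summable
  have hK : 0 ≤ K / (1 - q) := div_nonneg hK0 (by linarith)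
  have hle : ∀ y : Stack N d, ∀ s, 1 ≤ s →
      ∑' n, ‖evolve P s n (disagreement y)‖ ≤ K / (1 - q) * ‖disagreement y‖ := fun y s hs =>
    hpot s hs _ (sum_disagreement hN y)
  -- The series is a potential: the total future disagreement if all perturbations stopped. One step
  -- removes its zeroth term, the current disagreement, and a perturbation `u` adds at most `K / (1
  -- - q) * ‖disagreement u‖`.
  have main : ∑ t ∈ Ico 1 (T + 1), ‖disagreement (x t)‖ +
      ∑' n, ‖evolve P (T + 1) n (disagreement (x (T + 1)))‖ ≤
      K / (1 - q) * (‖disagreement (x 1)‖ + ∑ t ∈ Ico 1 (T + 1), ‖disagreement (u t)‖) := by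
    induction T with
    | zero => simpa using hle (x 1) 1 le_rfl
    | succ T ih =>
      have hIco : ∀ f : ℕ → ℝ, ∑ t ∈ Ico 1 (T + 1 + 1), f t =
          ∑ t ∈ Ico 1 (T + 1), f t + f (T + 1) := fun f => sum_Ico_succ_top (by omega) f
      rw [hIco, hIco]
      have hs := hsm (T + 1) (by omega) _ (sum_disagreement hN (x (T + 1)))
      rw [hs.tsum_eq_zero_add] at ih
      have hs' := hsm (T + 1 + 1) (by omega) _
        (sum_disagreement hN (blockAct (P (T + 1)) (x (T + 1))))
      have hs'' := hsm (T + 1 + 1) (by omega) _ (sum_disagreement hN (u (T + 1)))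
      have hs''' := hsm (T + 1 + 1) (by omega) _ (sum_disagreement hN (x (T + 1 + 1)))
      have h1 : ∑' n, ‖evolve P (T + 1 + 1) n (disagreement (x (T + 1 + 1)))‖ ≤
          ∑' n, ‖evolve P (T + 1) (n + 1) (disagreement (x (T + 1)))‖ +
            K / (1 - q) * ‖disagreement (u (T + 1))‖ := by
        refine le_trans ?_ (add_le_add_right (hle (u (T + 1)) (T + 1 + 1) (by omega)) _)
        simp_rw [evolve_succ', ← disagreement_blockAct (hP (T + 1) (by omega))]
        rw [← hs'.tsum_add hs'']
        refine hs'''.tsum_le_tsum (fun n => ?_) (hs'.add hs'')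
        rw [hx (T + 1) (by omega), disagreement_add, evolve_vadd]
        exact norm_add_le _ _
      simp only [evolve] at ih h1 ⊢
      linarith
  have h0 : 0 ≤ ∑' n, ‖evolve P (T + 1) n (disagreement (x (T + 1)))‖ :=
    tsum_nonneg fun _ => norm_nonneg _
  refine (le_add_of_nonneg_right h0).trans (main.trans (mul_le_mul_of_nonneg_left ?_ hK))
  exact add_le_add (norm_disagreement_le hN _) (sum_le_sum fun _ _ => norm_disagreement_le hN _)

end Stack

/-! ### The averaging matrices of the communication digraphs -/

lemma exists_edge_of_transGen {V : Type*} {R : V → V → Prop} (U : V → Prop) {i j : V}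
    (h : Relation.TransGen R i j) (hi : U i) (hj : ¬ U j) : ∃ a b, U a ∧ ¬ U b ∧ R a b := by
  induction h with
  | single h => exact ⟨_, _, hi, hj, h⟩
  | @tail b c _ hbc ih =>
    by_cases hb : U b
    · exact ⟨b, c, hb, hj, hbc⟩
    · exact ih hb

lemma one_sub_smul_laplacian_of_ne {N : ℕ} (G : WDigraph N) (σ : ℝ) {i j : Fin N} (h : i ≠ j) :
    (1 - σ • G.laplacian) i j = σ * G.adj i j := by
  simp [WDigraph.laplacian, h]

lemma one_sub_smul_laplacian_diag {N : ℕ} (G : WDigraph N) (σ : ℝ) (i : Fin N) :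
    (1 - σ • G.laplacian) i i = 1 - σ * (G.outDegree i - G.adj i i) := by
  simp [WDigraph.laplacian]

lemma isAveraging_one_sub_smul_laplacian {N : ℕ} {G : WDigraph N} (hG : G.WeightBalanced)
    {σ η dmax : ℝ} (hσ : 0 < σ) (hη : 0 < η) (hdeg : ∀ i, G.outDegree i ≤ dmax)
    (hdmax : η ≤ 1 - σ * dmax) (hadj : ∀ i j, 0 < G.adj i j → η ≤ σ * G.adj i j) :
    IsAveraging η (1 - σ • G.laplacian) := by
  have hdiag : ∀ i, η ≤ (1 - σ • G.laplacian) i i := by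
    intro i
    rw [one_sub_smul_laplacian_diag]
    nlinarith [hdeg i, G.adj_nonneg i i, mul_le_mul_of_nonneg_left (hdeg i) hσ.le,
      mul_nonneg hσ.le (G.adj_nonneg i i)]
  have hrow : ∀ i, ∑ j, G.laplacian i j = 0 := by
    intro i
    simp [WDigraph.laplacian, sum_sub_distrib, Matrix.diagonal_apply, WDigraph.outDegree]
  have hcol : ∀ j, ∑ i, G.laplacian i j = 0 := by
    intro j
    have := hG j
    simp [WDigraph.laplacian, sum_sub_distrib, Matrix.diagonal_apply, this, WDigraph.inDegree]
  refine ⟨mem_doublyStochastic_iff_sum.2 ⟨fun i j => ?_, fun i => ?_, fun j => ?_⟩, hdiag,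
    fun i j hij => ?_⟩
  · by_cases h : i = j
    · subst h
      exact hη.le.trans (hdiag i)
    · rw [one_sub_smul_laplacian_of_ne G σ h]
      exact mul_nonneg hσ.le (G.adj_nonneg i j)
  · simp [sum_sub_distrib, ← mul_sum, hrow, Matrix.one_apply]
  · simp [sum_sub_distrib, ← mul_sum, hcol, Matrix.one_apply]
  · by_cases h : i = j
    · subst h
      exact hdiag i
    · rw [one_sub_smul_laplacian_of_ne G σ h] at hij ⊢
      refine hadj i j ((G.adj_nonneg i j).lt_of_ne fun h0 => hij ?_)
      rw [← h0, mul_zero]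

lemma isConsensus_one_sub_smul_laplacian {N B : ℕ} {G : ℕ → WDigraph N} {δ σ η : ℝ}
    (hconn : JointlyConnected G B) (hnondeg : Nondegenerate G δ)
    (hbal : ∀ t, 1 ≤ t → (G t).WeightBalanced) (hdeg : BddAbove (outDegrees G)) (hσ : 0 < σ)
    (hη : 0 < η) (hδ : η ≤ σ * δ) (hdmax : η ≤ 1 - σ * maxOutDegree G) :
    IsConsensus B η fun t => 1 - σ • (G t).laplacian where
  averaging t ht := isAveraging_one_sub_smul_laplacian (hbal t ht) hσ hη
    (fun i => le_csSup hdeg ⟨t, ht, i, rfl⟩) hdmax fun i j hij =>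
      hδ.trans (mul_le_mul_of_nonneg_left (hnondeg t ht i j hij).le hσ.le)
  connected k hk U := by
    rintro ⟨i, hi⟩ ⟨j, hj⟩
    have hij : i ≠ j := fun h => hj (h ▸ hi)
    obtain ⟨a, b, ha, hb, hab⟩ := exists_edge_of_transGen U (hconn k hk i j hij) hi hj
    have hne : a ≠ b := fun h => hb (h ▸ ha)
    have hab : 0 < (∑ t ∈ Ico (k * B) ((k + 1) * B), (G t).adj) a b := hab
    rw [Matrix.sum_apply] at hab
    obtain ⟨t, ht, hpos⟩ := exists_lt_of_sum_lt (s := Ico (k * B) ((k + 1) * B)) (f := 0)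
      (g := fun t => (G t).adj a b) (by simpa using hab)
    rw [mem_Ico, add_mul, one_mul] at ht
    refine ⟨t - k * B, by omega, a, b, ha, hb, ?_⟩
    rw [Nat.add_sub_cancel' ht.1, one_sub_smul_laplacian_of_ne _ _ hne]
    exact (mul_pos hσ hpos).ne'

/-! ### Orthogonal projections -/

section Projection

variable {E F : Type*} [NormedAddCommGroup E] [InnerProductSpace ℝ E]
  [NormedAddCommGroup F] [InnerProductSpace ℝ F]

lemma IsProjection.inner_le_zero {S : Set E} (hS : Convex ℝ S) {x p y : E}
    (h : IsProjection S x p) (hy : y ∈ S) : inner ℝ (x - p) (y - p) ≤ 0 := by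
  refine (norm_eq_iInf_iff_real_inner_le_zero hS h.1).1 ?_ y hy
  have : Nonempty S := ⟨⟨p, h.1⟩⟩
  refine le_antisymm (le_ciInf fun w => h.2 w w.2) ?_
  exact ciInf_le ⟨0, by rintro _ ⟨w, rfl⟩; exact norm_nonneg _⟩ (⟨p, h.1⟩ : S)

/-- The angle at `p` between `x` and `y` is not acute, so `p` is at least as close to `y` as `x` is.
-/
lemma IsProjection.norm_sub_le {S : Set E} (hS : Convex ℝ S) {x p y : E}
    (h : IsProjection S x p) (hy : y ∈ S) : ‖p - y‖ ≤ ‖x - y‖ := by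
  have h1 := h.inner_le_zero hS hy
  have h2 := norm_add_sq_real (x - p) (p - y)
  rw [sub_add_sub_cancel, ← neg_sub y p, inner_neg_right, norm_neg] at h2
  rw [← abs_norm, ← abs_norm (x - y), ← sq_le_sq, ← norm_neg, neg_sub]
  nlinarith [sq_nonneg ‖x - p‖]

lemma norm_sq_pair_sub {E F : Type*} [NormedAddCommGroup E] [NormedAddCommGroup F]
    (x x' : E) (y y' : F) :
    ‖pair x y - pair x' y'‖ ^ 2 = ‖x - x'‖ ^ 2 + ‖y - y'‖ ^ 2 := by
  rw [WithLp.prod_norm_sq_eq_of_L2]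
  rfl

/-- Squared distances add, so minimality can be tested by varying one component alone. -/
lemma IsProjection.of_pair {E F : Type*} [NormedAddCommGroup E] [NormedAddCommGroup F]
    {S : Set E} {T : Set F} {x p : E} {y q : F}
    (h : IsProjection (pairSet S T) (pair x y) (pair p q)) :
    IsProjection S x p ∧ IsProjection T y q := by
  have key : ∀ x' ∈ S, ∀ y' ∈ T,
      ‖x - p‖ ^ 2 + ‖y - q‖ ^ 2 ≤ ‖x - x'‖ ^ 2 + ‖y - y'‖ ^ 2 := by
    intro x' hx' y' hy'
    rw [← norm_sq_pair_sub, ← norm_sq_pair_sub]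
    exact pow_le_pow_left₀ (norm_nonneg _) (h.2 (pair x' y') ⟨hx', hy'⟩) 2
  refine ⟨⟨h.1.1, fun x' hx' => ?_⟩, ⟨h.1.2, fun y' hy' => ?_⟩⟩
  · rw [← abs_norm, ← abs_norm (x - x'), ← sq_le_sq]
    linarith [key x' hx' q h.1.2]
  · rw [← abs_norm, ← abs_norm (y - y'), ← sq_le_sq]
    linarith [key p h.1.1 y' hy']

lemma convex_pairSet {S : Set E} {T : Set F} (hS : Convex ℝ S) (hT : Convex ℝ T) :
    Convex ℝ (pairSet S T) := fun _ hx _ hy _ _ ha hb hab =>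
  ⟨hS hx.1 hy.1 ha hb hab, hT hx.2 hy.2 ha hb hab⟩

end Projection

/-! ### Learning rates -/

lemma sum_one_div_sqrt_le (T : ℕ) : ∑ t ∈ Ico 1 (T + 1), 1 / √(t : ℝ) ≤ 2 * √T := by
  induction T with
  | zero => simp
  | succ T ih =>
    rw [sum_Ico_succ_top (by omega)]
    have h1 : (0 : ℝ) < √((T + 1 : ℕ) : ℝ) := Real.sqrt_pos.2 (by positivity)
    have h2 : √((T + 1 : ℕ) : ℝ) ^ 2 = √(T : ℝ) ^ 2 + 1 := by
      rw [Real.sq_sqrt (by positivity), Real.sq_sqrt (by positivity)]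
      push_cast
      ring
    have h3 : 1 / √((T + 1 : ℕ) : ℝ) ≤ 2 * (√((T + 1 : ℕ) : ℝ) - √(T : ℝ)) := by
      rw [div_le_iff₀ h1]
      nlinarith [sq_nonneg (√((T + 1 : ℕ) : ℝ) - √(T : ℝ))]
    linarith

lemma IsDoublingTrick.eq {η : ℕ → ℝ} (h : IsDoublingTrick η) {t : ℕ} (ht : 1 ≤ t) :
    η t = 1 / √(2 ^ Nat.log 2 t) :=
  h _ _ (Nat.pow_log_le_self 2 (by omega)) (Nat.lt_pow_succ_log_self (by norm_num) t)

lemma IsDoublingTrick.pos {η : ℕ → ℝ} (h : IsDoublingTrick η) {t : ℕ} (ht : 1 ≤ t) :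
    0 < η t := by
  rw [h.eq ht]
  positivity

lemma IsDoublingTrick.inv_mono {η : ℕ → ℝ} (h : IsDoublingTrick η) {s t : ℕ} (hs : 1 ≤ s)
    (hst : s ≤ t) : (η s)⁻¹ ≤ (η t)⁻¹ := by
  rw [h.eq hs, h.eq (hs.trans hst), one_div, one_div, inv_inv, inv_inv]
  exact Real.sqrt_le_sqrt (pow_le_pow_right₀ (by norm_num) (Nat.log_mono_right hst))

lemma IsDoublingTrick.inv_le_sqrt {η : ℕ → ℝ} (h : IsDoublingTrick η) {t : ℕ} (ht : 1 ≤ t) :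
    (η t)⁻¹ ≤ √t := by
  rw [h.eq ht, one_div, inv_inv]
  exact Real.sqrt_le_sqrt (by exact_mod_cast Nat.pow_log_le_self 2 (by omega))

lemma IsDoublingTrick.le_sqrt_two_mul {η : ℕ → ℝ} (h : IsDoublingTrick η) {t : ℕ} (ht : 1 ≤ t) :
    η t ≤ √2 * (1 / √t) := by
  have ht' : (0 : ℝ) < √t := Real.sqrt_pos.2 (by exact_mod_cast ht)
  rw [h.eq ht, mul_one_div, div_le_div_iff₀ (by positivity) ht', one_mul,
    ← Real.sqrt_mul (by norm_num)]
  refine Real.sqrt_le_sqrt ?_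
  -- Within epoch `m` one has `t < 2 * 2 ^ m`; this is the origin of the factor `√2`.
  have := (Nat.lt_pow_succ_log_self (b := 2) (by norm_num) t).le
  rw [pow_succ'] at this
  exact_mod_cast this

lemma IsDoublingTrick.sum_le {η : ℕ → ℝ} (h : IsDoublingTrick η) (T : ℕ) :
    ∑ t ∈ Ico 1 (T + 1), η t ≤ 2 * √2 * √T := by
  refine (sum_le_sum fun t ht => h.le_sqrt_two_mul (mem_Ico.1 ht).1).trans ?_
  rw [← mul_sum]
  nlinarith [sum_one_div_sqrt_le T, Real.sqrt_nonneg 2]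

/-- Summation by parts for a telescoping sum with monotone weights. -/
lemma sum_mul_sub_succ_le {c a : ℕ → ℝ} {R : ℝ} (hc1 : 0 ≤ c 1)
    (hc : ∀ s t, 1 ≤ s → s ≤ t → c s ≤ c t)
    (ha : ∀ t, 1 ≤ t → a t ≤ R) {T : ℕ} (hT : 1 ≤ T) :
    ∑ t ∈ Ico 1 (T + 1), c t * (a t - a (t + 1)) ≤ c T * (R - a (T + 1)) := by
  induction T, hT using Nat.le_induction with
  | base =>
    have := mul_le_mul_of_nonneg_left (ha 1 le_rfl) hc1
    simp only [Nat.Ico_succ_singleton, sum_singleton]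
    linarith
  | succ T hT ih =>
    rw [sum_Ico_succ_top (by omega)]
    have := mul_le_mul_of_nonneg_right (hc T (T + 1) hT (by omega))
      (sub_nonneg.2 (ha (T + 1) (by omega)))
    linarith

/-! ### Regret of the projected descent with averaging -/

/-- Projected subgradient descent in `(w, D)` for the losses `f t`, with averaging of the
blocks of `D` by the matrices `P t`, and uniform bounds on the states and subgradients. -/
structure IsDescent {E : Type*} [NormedAddCommGroup E] [InnerProductSpace ℝ E] {N d : ℕ}
    (W : Set E) (𝒟 : Set (EuclideanSpace ℝ (Fin d))) (P : ℕ → Matrix (Fin N) (Fin N) ℝ)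
    (η : ℕ → ℝ) (f : ℕ → Pair E (Stack N d) → ℝ) (w gw : ℕ → E) (D gD : ℕ → Stack N d)
    (Bw BD Hw HD : ℝ) : Prop where
  convex_left : Convex ℝ W
  convex_right : Convex ℝ 𝒟
  mem : ∀ t, 1 ≤ t → pair (w t) (D t) ∈ pairSet W (stackSet N 𝒟)
  subgradient : ∀ t, 1 ≤ t → IsSubgradient (pairSet W (stackSet N 𝒟)) (f t)
    (pair (w t) (D t)) (pair (gw t) (gD t))
  step_left : ∀ t, 1 ≤ t → IsProjection W (w t - η t • gw t) (w (t + 1))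
  step_right : ∀ t, 1 ≤ t →
    IsProjection (stackSet N 𝒟) (blockAct (P t) (D t) - η t • gD t) (D (t + 1))
  norm_left : ∀ t, 1 ≤ t → ‖w t‖ ≤ Bw
  norm_right : ∀ t, 1 ≤ t → ‖D t‖ ≤ BD
  norm_subgradient_left : ∀ t, 1 ≤ t → ‖gw t‖ ≤ Hw
  norm_subgradient_right : ∀ t, 1 ≤ t → ‖gD t‖ ≤ HD

namespace IsDescent

variable {E : Type*} [NormedAddCommGroup E] [InnerProductSpace ℝ E] {N d : ℕ}
  {W : Set E} {𝒟 : Set (EuclideanSpace ℝ (Fin d))} {P : ℕ → Matrix (Fin N) (Fin N) ℝ}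
  {η : ℕ → ℝ} {f : ℕ → Pair E (Stack N d) → ℝ} {w gw : ℕ → E} {D gD : ℕ → Stack N d}
  {Bw BD Hw HD : ℝ}

lemma bounds_nonneg (h : IsDescent W 𝒟 P η f w gw D gD Bw BD Hw HD) :
    0 ≤ Bw ∧ 0 ≤ BD ∧ 0 ≤ Hw ∧ 0 ≤ HD :=
  ⟨(norm_nonneg _).trans (h.norm_left 1 le_rfl), (norm_nonneg _).trans (h.norm_right 1 le_rfl),
    (norm_nonneg _).trans (h.norm_subgradient_left 1 le_rfl),
    (norm_nonneg _).trans (h.norm_subgradient_right 1 le_rfl)⟩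

/-- The potential is the distance to the agreed mean `m` of the comparator, which `P t` fixes, so
averaging does not increase it. Replacing `m - blockAct (P t) (D t)` by `p.snd - D t` in the inner
product costs the two disagreement terms. -/
lemma step_le (h : IsDescent W 𝒟 P η f w gw D gD Bw BD Hw HD) (hN : N ≠ 0)
    (hP : ∀ t, 1 ≤ t → P t ∈ doublyStochastic ℝ (Fin N)) (hη : IsDoublingTrick η)
    {p : Pair E (Stack N d)} (hp : p ∈ pairSet W (stackSet N 𝒟)) {t : ℕ} (ht : 1 ≤ t) :
    2 * (f t (pair (w t) (D t)) - f t p) ≤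
      (η t)⁻¹ * ((‖w t - p.fst‖ ^ 2 + ‖D t - agree N (blockMean p.snd)‖ ^ 2) -
        (‖w (t + 1) - p.fst‖ ^ 2 + ‖D (t + 1) - agree N (blockMean p.snd)‖ ^ 2)) +
      η t * (Hw ^ 2 + HD ^ 2) + 4 * HD * ‖disagreement (D t)‖ +
      2 * HD * ‖disagreement p.snd‖ := by
  have hη0 := hη.pos ht
  obtain ⟨-, -, hHw, hHD⟩ := h.bounds_nonneg
  have hgw := h.norm_subgradient_left t ht
  have hgD := h.norm_subgradient_right t ht
  have hmem : agree N (blockMean p.snd) ∈ stackSet N 𝒟 := fun i =>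
    blockMean_mem hN h.convex_right hp.2
  set m := agree N (blockMean p.snd)
  have hsub : inner ℝ (gw t) (p.fst - w t) + inner ℝ (gD t) (p.snd - D t) ≤
      f t p - f t (pair (w t) (D t)) := (h.subgradient t ht).2 p hp
  have h1 : ‖w (t + 1) - p.fst‖ ^ 2 ≤ ‖w t - p.fst‖ ^ 2 +
      2 * η t * inner ℝ (gw t) (p.fst - w t) + η t ^ 2 * Hw ^ 2 := by
    have h1 := (h.step_left t ht).norm_sub_le h.convex_left hp.1
    have h2 := norm_sub_sq_real (w t - p.fst) (η t • gw t)
    rw [inner_smul_right, real_inner_comm, norm_smul, Real.norm_of_nonneg hη0.le,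
      ← neg_sub p.fst (w t), inner_neg_right, norm_neg, mul_pow] at h2
    rw [sub_right_comm, ← neg_sub p.fst (w t)] at h1
    have h3 := pow_le_pow_left₀ (norm_nonneg _) h1 2
    have h4 := pow_le_pow_left₀ (norm_nonneg _) hgw 2
    rw [norm_sub_rev (w t)]
    nlinarith [mul_le_mul_of_nonneg_left h4 (sq_nonneg (η t))]
  have h2 : ‖D (t + 1) - m‖ ^ 2 ≤ ‖D t - m‖ ^ 2 +
      2 * η t * inner ℝ (gD t) (m - blockAct (P t) (D t)) + η t ^ 2 * HD ^ 2 := by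
    have h1 := (h.step_right t ht).norm_sub_le (convex_stackSet h.convex_right) hmem
    have h2 := norm_sub_sq_real (blockAct (P t) (D t) - m) (η t • gD t)
    have h0 : ‖blockAct (P t) (D t) - m‖ ≤ ‖D t - m‖ := by
      have := norm_blockAct_le (hP t ht) (D t - m)
      rwa [blockAct_sub, blockAct_agree (hP t ht)] at this
    rw [inner_smul_right, real_inner_comm, norm_smul, Real.norm_of_nonneg hη0.le,
      ← neg_sub m, inner_neg_right, norm_neg, mul_pow] at h2
    rw [sub_right_comm, ← neg_sub m (blockAct (P t) (D t))] at h1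
    rw [norm_sub_rev] at h0
    have h3 := pow_le_pow_left₀ (norm_nonneg _) h1 2
    have h4 := pow_le_pow_left₀ (norm_nonneg _) hgD 2
    have h5 := pow_le_pow_left₀ (norm_nonneg _) h0 2
    nlinarith [mul_le_mul_of_nonneg_left h4 (sq_nonneg (η t))]
  have h3 : inner ℝ (gD t) (m - blockAct (P t) (D t)) ≤ inner ℝ (gD t) (p.snd - D t) +
      2 * HD * ‖disagreement (D t)‖ + HD * ‖disagreement p.snd‖ := by
    have e : m - blockAct (P t) (D t) =
        (p.snd - D t) + (D t - blockAct (P t) (D t)) - disagreement p.snd := by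
      rw [disagreement]
      abel
    rw [e, inner_sub_right, inner_add_right]
    have h1 := real_inner_le_norm (gD t) (D t - blockAct (P t) (D t))
    have h2 := neg_le_of_abs_le (abs_real_inner_le_norm (gD t) (disagreement p.snd))
    have h3 := mul_le_mul hgD (norm_sub_blockAct_le (hP t ht) (D t)) (norm_nonneg _) hHD
    have h4 := mul_le_mul_of_nonneg_right hgD (norm_nonneg (disagreement p.snd))
    linarith
  have hinv : (η t)⁻¹ * η t = 1 := inv_mul_cancel₀ hη0.ne'
  have key : 2 * η t * (f t (pair (w t) (D t)) - f t p) ≤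
      ((‖w t - p.fst‖ ^ 2 + ‖D t - m‖ ^ 2) - (‖w (t + 1) - p.fst‖ ^ 2 + ‖D (t + 1) - m‖ ^ 2)) +
      η t * (η t * (Hw ^ 2 + HD ^ 2) + 4 * HD * ‖disagreement (D t)‖ +
      2 * HD * ‖disagreement p.snd‖) := by
    have h4 := mul_le_mul_of_nonneg_left h3 hη0.le
    have h5 := mul_le_mul_of_nonneg_left hsub hη0.le
    linarith
  have := mul_le_mul_of_nonneg_left key (inv_nonneg.2 hη0.le)
  rw [mul_add (η t)⁻¹, ← mul_assoc, ← mul_assoc (η t)⁻¹ (η t), hinv, mul_left_comm _ 2, hinv]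
    at this
  linarith

lemma sum_disagreement_le (h : IsDescent W 𝒟 P η f w gw D gD Bw BD Hw HD) (hN : N ≠ 0)
    {B : ℕ} (hB : 1 ≤ B) {θ : ℝ} (hθ : 0 < θ) (hθ1 : θ ≤ 1) (hP : IsConsensus B θ P)
    (hη : IsDoublingTrick η) {T : ℕ} (hT : 1 ≤ T) :
    ∑ t ∈ Ico 1 (T + 1), ‖disagreement (D t)‖ ≤
      √T * (Cu N B θ / 2 * (BD + 2 * √2 * HD)) := by
  have hds : ∀ t, 1 ≤ t → P t ∈ doublyStochastic ℝ (Fin N) := fun t ht => (hP.averaging t ht).mem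
  obtain ⟨-, hBD, -, hHD⟩ := h.bounds_nonneg
  have hN' : (1 : ℝ) ≤ (N : ℝ) ^ 2 := one_le_pow₀ (by exact_mod_cast Nat.pos_of_ne_zero hN)
  have hpos : 0 < θ / (4 * (N : ℝ) ^ 2) := by positivity
  have hlt : θ / (4 * (N : ℝ) ^ 2) < 1 := by
    rw [div_lt_one (by positivity)]
    linarith
  set q := (1 - θ / (4 * (N : ℝ) ^ 2)) ^ (1 / (B : ℝ)) with hq
  have hB' : (0 : ℝ) < B := by exact_mod_cast hB
  have hq0 : 0 ≤ q := Real.rpow_nonneg (by linarith) _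
  have hq1 : q < 1 := Real.rpow_lt_one (by linarith) (by linarith) (by positivity)
  have hCu : Cu N B θ / 2 = 16 / 9 / (1 - q) := by
    rw [Cu, ← hq, div_right_comm]
    norm_num
  -- By convexity `blockAct (P t) (D t)` is itself feasible, so the projected point is no farther
  -- from it than the gradient step is long.
  have hu : ∀ t ∈ Ico 1 (T + 1), ‖D (t + 1) - blockAct (P t) (D t)‖ ≤ η t * HD := by
    intro t ht
    have ht := (mem_Ico.1 ht).1
    have hmem : blockAct (P t) (D t) ∈ stackSet N 𝒟 :=
      blockAct_mem_stackSet h.convex_right (hds t ht) (h.mem t ht).2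
    refine ((h.step_right t ht).norm_sub_le (convex_stackSet h.convex_right) hmem).trans ?_
    rw [sub_right_comm, sub_self, zero_sub, norm_neg, norm_smul,
      Real.norm_of_nonneg (hη.pos ht).le]
    exact mul_le_mul_of_nonneg_left (h.norm_subgradient_right t ht) (hη.pos ht).le
  have main := sum_norm_disagreement_le hN hds (K := 16 / 9) (by norm_num) hq0 hq1
    (fun s hs x hx n => hP.norm_evolve_le_geometric hB hθ.le hθ1 hN hs hx n)
    (x := D) (u := fun t => D (t + 1) - blockAct (P t) (D t)) (fun t _ => by abel) T
  rw [← hCu] at main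
  have hCu0 : 0 ≤ Cu N B θ / 2 := by
    rw [hCu]
    exact div_nonneg (by norm_num) (by linarith)
  -- Used to absorb the initial term `‖D 1‖`, which carries no `√T`.
  have hT1 : 1 ≤ √(T : ℝ) := Real.one_le_sqrt.2 (by exact_mod_cast hT)
  have hsum := (sum_le_sum hu).trans_eq (sum_mul _ _ _).symm
  have h1 := mul_le_mul_of_nonneg_right (hη.sum_le T) hHD
  have h2 := h.norm_right 1 le_rfl
  refine main.trans ?_
  rw [mul_left_comm]
  refine mul_le_mul_of_nonneg_left ?_ hCu0
  nlinarith

/-- Summing `step_le`, the distances telescope against the increasing weights `(η t)⁻¹ ≤ √t`; the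
gradient and disagreement terms are each `O(√T)`. Only the comparator's own disagreement grows
linearly in `T`. -/
lemma regret_le (h : IsDescent W 𝒟 P η f w gw D gD Bw BD Hw HD) (hN : N ≠ 0)
    {B : ℕ} (hB : 1 ≤ B) {θ : ℝ} (hθ : 0 < θ) (hθ1 : θ ≤ 1) (hP : IsConsensus B θ P)
    (hη : IsDoublingTrick η) {p : Pair E (Stack N d)} (hp : p ∈ pairSet W (stackSet N 𝒟))
    {T : ℕ} (hT : 1 ≤ T) :
    2 * ∑ t ∈ Ico 1 (T + 1), (f t (pair (w t) (D t)) - f t p) ≤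
      √T * ((Bw + ‖p.fst‖) ^ 2 + (BD + ‖p.snd‖) ^ 2 + (2 * √2 * (Hw ^ 2 + HD ^ 2) +
        4 * (HD * (Cu N B θ / 2 * (BD + 2 * √2 * HD))))) +
      T * (2 * (HD * ‖disagreement p.snd‖)) := by
  have hds : ∀ t, 1 ≤ t → P t ∈ doublyStochastic ℝ (Fin N) := fun t ht => (hP.averaging t ht).mem
  obtain ⟨hBw, hBD, -, hHD⟩ := h.bounds_nonneg
  let a : ℕ → ℝ := fun t => ‖w t - p.fst‖ ^ 2 + ‖D t - agree N (blockMean p.snd)‖ ^ 2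
  have ha : ∀ t, 1 ≤ t → a t ≤ (Bw + ‖p.fst‖) ^ 2 + (BD + ‖p.snd‖) ^ 2 := by
    intro t ht
    refine add_le_add (pow_le_pow_left₀ (norm_nonneg _) ?_ 2)
      (pow_le_pow_left₀ (norm_nonneg _) ?_ 2)
    · exact (_root_.norm_sub_le _ _).trans (add_le_add (h.norm_left t ht) le_rfl)
    · exact (_root_.norm_sub_le _ _).trans
        (add_le_add (h.norm_right t ht) (norm_agree_blockMean_le hN _))
  have h1 := sum_mul_sub_succ_le (inv_nonneg.2 (hη.pos le_rfl).le)
    (fun s t hs hst => hη.inv_mono hs hst) ha hT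
  have h2 : (η T)⁻¹ * ((Bw + ‖p.fst‖) ^ 2 + (BD + ‖p.snd‖) ^ 2 - a (T + 1)) ≤
      √T * ((Bw + ‖p.fst‖) ^ 2 + (BD + ‖p.snd‖) ^ 2) := by
    refine mul_le_mul (hη.inv_le_sqrt hT) ?_ (sub_nonneg.2 (ha _ (by omega)))
      (Real.sqrt_nonneg _)
    exact sub_le_self _ (by positivity)
  have h3 := sum_le_sum fun t (ht : t ∈ Ico 1 (T + 1)) =>
    h.step_le hN hds hη hp (mem_Ico.1 ht).1
  rw [sum_add_distrib, sum_add_distrib, sum_add_distrib, ← sum_mul, ← mul_sum, ← mul_sum,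
    sum_const, Nat.card_Ico, nsmul_eq_mul, Nat.add_sub_cancel] at h3
  have h4 := mul_le_mul_of_nonneg_right (hη.sum_le T)
    (add_nonneg (sq_nonneg Hw) (sq_nonneg HD))
  have h5 := mul_le_mul_of_nonneg_left (h.sum_disagreement_le hN hB hθ hθ1 hP hη hT) hHD
  linarith

end IsDescent

open Filter Topology

/-! ### Time averages -/

section TimeAvg

variable {E F : Type*}

lemma timeAvg_succ [AddCommGroup E] [Module ℝ E] (x : ℕ → E) (T : ℕ) :
    timeAvg x (T + 1) = (T : ℝ)⁻¹ • ∑ s ∈ Ico 1 (T + 1), x s := by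
  simp [timeAvg]

lemma pair_timeAvg [NormedAddCommGroup E] [InnerProductSpace ℝ E]
    [NormedAddCommGroup F] [InnerProductSpace ℝ F] (x : ℕ → E) (y : ℕ → F) (t : ℕ) :
    pair (timeAvg x t) (timeAvg y t) = timeAvg (fun s => pair (x s) (y s)) t := by
  have h : ∀ s : Finset ℕ, ∑ i ∈ s, pair (x i) (y i) = pair (∑ i ∈ s, x i) (∑ i ∈ s, y i) := by
    intro s
    induction s using Finset.induction_on with
    | empty => rfl
    | insert a s ha ih => rw [sum_insert ha, sum_insert ha, sum_insert ha, ih]; rfl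
  rw [timeAvg, timeAvg, timeAvg, h]
  rfl

lemma sum_weights {T : ℕ} (hT : 1 ≤ T) : ∑ _s ∈ Ico 1 (T + 1), (T : ℝ)⁻¹ = 1 := by
  have : (T : ℝ) ≠ 0 := Nat.cast_ne_zero.2 (by omega)
  simp [this]

lemma timeAvg_mem [AddCommGroup E] [Module ℝ E] {S : Set E} (hS : Convex ℝ S) {x : ℕ → E}
    (hx : ∀ t, 1 ≤ t → x t ∈ S) {T : ℕ} (hT : 1 ≤ T) : timeAvg x (T + 1) ∈ S := by
  rw [timeAvg_succ, smul_sum]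
  exact hS.sum_mem (fun _ _ => by positivity) (sum_weights hT) fun s hs => hx s (mem_Ico.1 hs).1

lemma map_timeAvg_le_of_convexOn [AddCommGroup E] [Module ℝ E] {S : Set E} {f : E → ℝ}
    (hf : ConvexOn ℝ S f) {x : ℕ → E} (hx : ∀ t, 1 ≤ t → x t ∈ S) {T : ℕ} (hT : 1 ≤ T) :
    f (timeAvg x (T + 1)) ≤ timeAvg (fun t => f (x t)) (T + 1) := by
  rw [timeAvg_succ, timeAvg_succ, smul_sum, smul_sum]
  exact hf.map_sum_le (fun _ _ => by positivity) (sum_weights hT)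
    fun s hs => hx s (mem_Ico.1 hs).1

lemma norm_timeAvg_le [NormedAddCommGroup E] [NormedSpace ℝ E] {x : ℕ → E} {C : ℝ}
    (hx : ∀ t, 1 ≤ t → ‖x t‖ ≤ C) {T : ℕ} (hT : 1 ≤ T) : ‖timeAvg x (T + 1)‖ ≤ C := by
  have := timeAvg_mem (convex_closedBall (0 : E) C) (x := x)
    (fun t ht => mem_closedBall_zero_iff.2 (hx t ht)) hT
  exact mem_closedBall_zero_iff.1 this

end TimeAvg

/-! ### From regret bounds to the saddle value -/

/-- If both players have small regret against every comparator, up to penalties that are small at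
their own averages, then the value at the averages exceeds the saddle value by little. The bound
does not depend on the size of the saddle point `xs`, since the comparator of the first player
can be taken to be its own average over a much longer horizon. -/
lemma two_mul_value_sub_le {X Y : Type*} {f : X → Y → ℝ} {SX : Set X} {SY : Set Y}
    {x : ℕ → X} {y : ℕ → Y} {A : ℕ → ℝ} {dX RX : X → ℝ} {dY RY : Y → ℝ}
    {KX KY bX bY eX eY v : ℝ} {xs : X}
    (hx : ∀ T, 1 ≤ T → x T ∈ SX) (hy : ∀ T, 1 ≤ T → y T ∈ SY)
    (hX : ∀ T : ℕ, 1 ≤ T → ∀ p ∈ SX, 2 * (A T - f p (y T)) ≤ (RX p + KX) / √T + 2 * dX p)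
    (hY : ∀ T : ℕ, 1 ≤ T → ∀ q ∈ SY, 2 * (f (x T) q - A T) ≤ (RY q + KY) / √T + 2 * dY q)
    (hdX : ∀ T : ℕ, 1 ≤ T → dX (x T) ≤ eX / √T) (hdY : ∀ T : ℕ, 1 ≤ T → dY (y T) ≤ eY / √T)
    (hRX : ∀ T, 1 ≤ T → RX (x T) ≤ bX) (hRY : ∀ T, 1 ≤ T → RY (y T) ≤ bY)
    (hxs : xs ∈ SX) (hdxs : dX xs = 0) (hv : ∀ T, 1 ≤ T → f xs (y T) ≤ v)
    {T : ℕ} (hT : 1 ≤ T) :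
    2 * (f (x T) (y T) - v) ≤ (bX + KX + (bY + KY) + 4 * eY) / √T := by
  have key : ∀ S : ℕ, 1 ≤ S → 2 * (f (x T) (y T) - v) ≤
      (bX + KX + (bY + KY) + 4 * eY) / √T + (2 * eX + (bY + KY) + (RX xs + KX)) / √S := by
    intro S hS
    -- The difference `f (x T) (y T) - v` is split through `A T`, `f (x S) (y T)`, `A S` and `f xs
    -- (y S)`. The penalty of `y T` enters at both horizons, hence `4 * eY`; every other
    -- contribution from horizon `S` is `O(1/√S)`.
    have h1 := hY T hT _ (hy T hT)
    have h2 := hX T hT _ (hx S hS)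
    have h3 := hY S hS _ (hy T hT)
    have h4 := hX S hS _ hxs
    have r1 : (RY (y T) + KY) / √T ≤ (bY + KY) / √T := by gcongr; exact hRY T hT
    have r2 : (RX (x S) + KX) / √T ≤ (bX + KX) / √T := by gcongr; exact hRX S hS
    have r3 : (RY (y T) + KY) / √S ≤ (bY + KY) / √S := by gcongr; exact hRY T hT
    have h5 := hdX S hS
    have h6 := hdY T hT
    have h7 := hv S hS
    simp only [add_div, mul_div_assoc] at *
    linarith
  have hlim : Tendsto (fun S : ℕ => (bX + KX + (bY + KY) + 4 * eY) / √T +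
      (2 * eX + (bY + KY) + (RX xs + KX)) / √S) atTop
      (𝓝 ((bX + KX + (bY + KY) + 4 * eY) / √T + 0)) :=
    tendsto_const_nhds.add (tendsto_const_nhds.div_atTop
      (Real.tendsto_sqrt_atTop.comp tendsto_natCast_atTop_atTop))
  rw [add_zero] at hlim
  exact ge_of_tendsto hlim (eventually_atTop.2 ⟨1, key⟩)

/-! ### Averages of the projected descent -/

namespace IsDescent

variable {E : Type*} [NormedAddCommGroup E] [InnerProductSpace ℝ E] {N d : ℕ}
  {W : Set E} {𝒟 : Set (EuclideanSpace ℝ (Fin d))} {P : ℕ → Matrix (Fin N) (Fin N) ℝ}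
  {η : ℕ → ℝ} {f : ℕ → Pair E (Stack N d) → ℝ} {w gw : ℕ → E} {D gD : ℕ → Stack N d}
  {Bw BD Hw HD : ℝ}

lemma disagreement_timeAvg_le (h : IsDescent W 𝒟 P η f w gw D gD Bw BD Hw HD) (hN : N ≠ 0)
    {B : ℕ} (hB : 1 ≤ B) {θ : ℝ} (hθ : 0 < θ) (hθ1 : θ ≤ 1) (hP : IsConsensus B θ P)
    (hη : IsDoublingTrick η) {T : ℕ} (hT : 1 ≤ T) :
    HD * ‖disagreement (timeAvg D (T + 1))‖ ≤
      HD * (Cu N B θ / 2 * (BD + 2 * √2 * HD)) / √T := by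
  obtain ⟨-, -, -, hHD⟩ := h.bounds_nonneg
  have hT0 : (0 : ℝ) < T := by exact_mod_cast hT
  rw [mul_div_assoc]
  refine mul_le_mul_of_nonneg_left ?_ hHD
  rw [timeAvg_succ, disagreement_smul, disagreement_sum, norm_smul, norm_inv, Real.norm_natCast,
    inv_mul_le_iff₀ hT0]
  refine (norm_sum_le _ _).trans
    ((h.sum_disagreement_le hN hB hθ hθ1 hP hη hT).trans_eq ?_)
  rw [mul_div_assoc', mul_comm (T : ℝ), mul_div_assoc, Real.div_sqrt, mul_comm]

lemma timeAvg_regret_le (h : IsDescent W 𝒟 P η f w gw D gD Bw BD Hw HD) (hN : N ≠ 0)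
    {B : ℕ} (hB : 1 ≤ B) {θ : ℝ} (hθ : 0 < θ) (hθ1 : θ ≤ 1) (hP : IsConsensus B θ P)
    (hη : IsDoublingTrick η) {p : Pair E (Stack N d)} (hp : p ∈ pairSet W (stackSet N 𝒟))
    {T : ℕ} (hT : 1 ≤ T) :
    2 * (timeAvg (fun t => f t (pair (w t) (D t))) (T + 1) -
        timeAvg (fun t => f t p) (T + 1)) ≤
      ((Bw + ‖p.fst‖) ^ 2 + (BD + ‖p.snd‖) ^ 2 + (2 * √2 * (Hw ^ 2 + HD ^ 2) +
        4 * (HD * (Cu N B θ / 2 * (BD + 2 * √2 * HD))))) / √T +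
      2 * (HD * ‖disagreement p.snd‖) := by
  have hT0 : (0 : ℝ) < T := by exact_mod_cast hT
  have h1 := h.regret_le hN hB hθ hθ1 hP hη hp hT
  rw [timeAvg_succ, timeAvg_succ, ← smul_sub, ← sum_sub_distrib, smul_eq_mul, mul_left_comm,
    inv_mul_le_iff₀ hT0]
  refine h1.trans_eq ?_
  rw [mul_add (T : ℝ), mul_div_assoc', mul_div_right_comm, Real.div_sqrt]

lemma timeAvg_mem_pairSet (h : IsDescent W 𝒟 P η f w gw D gD Bw BD Hw HD) {T : ℕ} (hT : 1 ≤ T) :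
    pair (timeAvg w (T + 1)) (timeAvg D (T + 1)) ∈ pairSet W (stackSet N 𝒟) :=
  pair_timeAvg w D (T + 1) ▸
    timeAvg_mem (convex_pairSet h.convex_left (convex_stackSet h.convex_right)) h.mem hT

/-- The averages inherit the bounds on the iterates, so each square is at most `(2 * B) ^ 2`. -/
lemma add_norm_timeAvg_sq_le (h : IsDescent W 𝒟 P η f w gw D gD Bw BD Hw HD) {T : ℕ}
    (hT : 1 ≤ T) :
    (Bw + ‖timeAvg w (T + 1)‖) ^ 2 + (BD + ‖timeAvg D (T + 1)‖) ^ 2 ≤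
      4 * (Bw ^ 2 + BD ^ 2) := by
  obtain ⟨hBw, hBD, -, -⟩ := h.bounds_nonneg
  have h1 := norm_timeAvg_le h.norm_left hT
  have h2 := norm_timeAvg_le h.norm_right hT
  nlinarith [norm_nonneg (timeAvg w (T + 1)), norm_nonneg (timeAvg D (T + 1))]

end IsDescent

/-- The evaluation constant dominates the constant of the regret bound, with the disagreement
counted twice. -/
lemma le_evalConst {bx by' hx hy σ Λ c : ℝ} (hby : 0 ≤ by') (hhy : 0 ≤ hy) (hσ : 0 ≤ σ)
    (hΛ : 0 ≤ Λ) (hc : 0 ≤ c) :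
    4 * (bx ^ 2 + by' ^ 2) + (2 * √2 * (hx ^ 2 + hy ^ 2) +
      8 * (hy * (c / 2 * (by' + 2 * √2 * hy)))) ≤ evalConst bx by' hx hy σ Λ c := by
  have h2 : √(2 : ℝ) ^ 2 = 2 := Real.sq_sqrt (by norm_num)
  have hs1 : 1.4 ≤ √(2 : ℝ) := Real.le_sqrt_of_sq_le (by norm_num)
  have hs2 : √(2 : ℝ) ≤ 1.5 := Real.sqrt_le_iff.2 ⟨by norm_num, by norm_num⟩
  have hK : (2 : ℝ) ≤ √2 / (√2 - 1) := by
    rw [le_div_iff₀ (by linarith)]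
    linarith
  have hp1 : 0 ≤ hy * c := mul_nonneg hhy hc
  have hp2 : 0 ≤ hy * c * by' := mul_nonneg hp1 hby
  have hp3 : 0 ≤ hy * c * hy := mul_nonneg hp1 hhy
  -- The tight coefficient: `8 * √2` on the left against `2 * 3 * 2 = 12` on the right, which `√2 ≤
  -- 1.5` just allows.
  have hp4 : hy * c * hy * √2 ≤ hy * c * hy * 1.5 := mul_le_mul_of_nonneg_left hs2 hp3
  have hp5 : 0 ≤ σ * Λ * (hy * c * (by' + 2 * hy)) := by positivity
  have h : 0 ≤ 4 * (bx ^ 2 + by' ^ 2) + 6 * (hx ^ 2 + hy ^ 2) +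
      hy * (3 + σ * Λ) * c * (by' + 2 * hy) := by positivity
  have hH : √2 * (hx ^ 2 + hy ^ 2) ≤ 1.5 * (hx ^ 2 + hy ^ 2) :=
    mul_le_mul_of_nonneg_right hs2 (by positivity)
  refine le_trans ?_ (mul_le_mul_of_nonneg_right hK h)
  nlinarith [sq_nonneg bx, sq_nonneg by', sq_nonneg hx, sq_nonneg hy]

lemma Cu_nonneg {N B : ℕ} {θ : ℝ} (hN : N ≠ 0) (hθ : 0 < θ) (hθ1 : θ ≤ 1) : 0 ≤ Cu N B θ := by
  have hN' : (1 : ℝ) ≤ (N : ℝ) ^ 2 := one_le_pow₀ (by exact_mod_cast Nat.pos_of_ne_zero hN)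
  have hpos : 0 < θ / (4 * (N : ℝ) ^ 2) := by positivity
  have hlt : θ / (4 * (N : ℝ) ^ 2) < 1 := by
    rw [div_lt_one (by positivity)]
    linarith
  exact div_nonneg (by norm_num)
    (sub_nonneg.2 (Real.rpow_le_one (by linarith) (by linarith) (by positivity)))

/-- Two players running the averaged descent against each other: the value at the averages
exceeds the saddle value by little. -/
lemma value_timeAvg_sub_le {E F : Type*} [NormedAddCommGroup E] [InnerProductSpace ℝ E]
    [NormedAddCommGroup F] [InnerProductSpace ℝ F] {N d e : ℕ} {W : Set E} {M : Set F}
    {𝒟 : Set (EuclideanSpace ℝ (Fin d))} {𝒵 : Set (EuclideanSpace ℝ (Fin e))}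
    {P : ℕ → Matrix (Fin N) (Fin N) ℝ} {η : ℕ → ℝ}
    {f : Pair E (Stack N d) → Pair F (Stack N e) → ℝ}
    {w gw : ℕ → E} {D gD : ℕ → Stack N d} {μ gμ : ℕ → F} {z gz : ℕ → Stack N e}
    {Bw BD Hw HD Bμ Bz Hμ Hz : ℝ}
    (hf : ∀ q ∈ pairSet M (stackSet N 𝒵), ConvexOn ℝ (pairSet W (stackSet N 𝒟)) fun p => f p q)
    (hf' : ∀ p ∈ pairSet W (stackSet N 𝒟), ConvexOn ℝ (pairSet M (stackSet N 𝒵)) fun q => -f p q)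
    (h : IsDescent W 𝒟 P η (fun t p => f p (pair (μ t) (z t))) w gw D gD Bw BD Hw HD)
    (h' : IsDescent M 𝒵 P η (fun t q => -f (pair (w t) (D t)) q) μ gμ z gz Bμ Bz Hμ Hz)
    (hN : N ≠ 0) {B : ℕ} (hB : 1 ≤ B) {θ : ℝ} (hθ : 0 < θ) (hθ1 : θ ≤ 1)
    (hP : IsConsensus B θ P) (hη : IsDoublingTrick η) {σ Λ : ℝ} (hσ : 0 ≤ σ) (hΛ : 0 ≤ Λ)
    {ws : E} {Ds : EuclideanSpace ℝ (Fin d)} {v : ℝ}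
    (hs : pair ws (agree N Ds) ∈ pairSet W (stackSet N 𝒟))
    (hv : ∀ q ∈ pairSet M (stackSet N 𝒵), f (pair ws (agree N Ds)) q ≤ v)
    {T : ℕ} (hT : 1 ≤ T) :
    f (pair (timeAvg w (T + 1)) (timeAvg D (T + 1)))
        (pair (timeAvg μ (T + 1)) (timeAvg z (T + 1))) - v ≤
      (evalConst Bw BD Hw HD σ Λ (Cu N B θ) + evalConst Bμ Bz Hμ Hz σ Λ (Cu N B θ)) /
        (2 * √T) := by
  obtain ⟨hBw, hBD, hHw, hHD⟩ := h.bounds_nonneg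
  obtain ⟨hBμ, hBz, hHμ, hHz⟩ := h'.bounds_nonneg
  have hCu := Cu_nonneg (B := B) hN hθ hθ1
  have hneg : ∀ (a : ℕ → ℝ) T, timeAvg (fun t => -a t) T = -timeAvg a T := by
    intro a T
    simp [timeAvg]
  let A : ℕ → ℝ := fun T => timeAvg (fun t => f (pair (w t) (D t)) (pair (μ t) (z t))) (T + 1)
  let x : ℕ → Pair E (Stack N d) := fun T => pair (timeAvg w (T + 1)) (timeAvg D (T + 1))
  let y : ℕ → Pair F (Stack N e) := fun T => pair (timeAvg μ (T + 1)) (timeAvg z (T + 1))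
  have hX : ∀ T : ℕ, 1 ≤ T → ∀ p ∈ pairSet W (stackSet N 𝒟), 2 * (A T - f p (y T)) ≤
      ((Bw + ‖p.fst‖) ^ 2 + (BD + ‖p.snd‖) ^ 2 + (2 * √2 * (Hw ^ 2 + HD ^ 2) +
        4 * (HD * (Cu N B θ / 2 * (BD + 2 * √2 * HD))))) / √T +
      2 * (HD * ‖disagreement p.snd‖) := by
    intro T hT p hp
    refine le_trans ?_ (h.timeAvg_regret_le hN hB hθ hθ1 hP hη hp hT)
    -- Jensen in the opponent's variable replaces the average of the losses at `p` by the loss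
    -- against the average opponent.
    have hj := map_timeAvg_le_of_convexOn (hf' p hp) h'.mem hT
    rw [hneg, ← pair_timeAvg, neg_le_neg_iff] at hj
    exact mul_le_mul_of_nonneg_left (sub_le_sub_left hj _) (by norm_num)
  have hY : ∀ T : ℕ, 1 ≤ T → ∀ q ∈ pairSet M (stackSet N 𝒵), 2 * (f (x T) q - A T) ≤
      ((Bμ + ‖q.fst‖) ^ 2 + (Bz + ‖q.snd‖) ^ 2 + (2 * √2 * (Hμ ^ 2 + Hz ^ 2) +
        4 * (Hz * (Cu N B θ / 2 * (Bz + 2 * √2 * Hz))))) / √T +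
      2 * (Hz * ‖disagreement q.snd‖) := by
    intro T hT q hq
    refine le_trans ?_ (h'.timeAvg_regret_le hN hB hθ hθ1 hP hη hq hT)
    have hj := map_timeAvg_le_of_convexOn (hf q hq) h.mem hT
    rw [← pair_timeAvg] at hj
    rw [hneg, hneg, neg_sub_neg]
    exact mul_le_mul_of_nonneg_left (sub_le_sub_right hj _) (by norm_num)
  have main := two_mul_value_sub_le
    (dX := fun p : Pair E (Stack N d) => HD * ‖disagreement p.snd‖)
    (dY := fun q : Pair F (Stack N e) => Hz * ‖disagreement q.snd‖)
    (fun T hT => h.timeAvg_mem_pairSet hT) (fun T hT => h'.timeAvg_mem_pairSet hT) hX hY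
    (fun T hT => h.disagreement_timeAvg_le hN hB hθ hθ1 hP hη hT)
    (fun T hT => h'.disagreement_timeAvg_le hN hB hθ hθ1 hP hη hT)
    (fun T hT => h.add_norm_timeAvg_sq_le hT) (fun T hT => h'.add_norm_timeAvg_sq_le hT)
    hs (by simp [disagreement_agree hN]) (fun T hT => hv _ (h'.timeAvg_mem_pairSet hT)) hT
  have hT0 : (0 : ℝ) < √T := Real.sqrt_pos.2 (by exact_mod_cast hT)
  have hcX := le_evalConst (bx := Bw) (hx := Hw) hBD hHD hσ hΛ hCu
  have hcY := le_evalConst (bx := Bμ) (hx := Hμ) hBz hHz hσ hΛ hCu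
  have hE : 0 ≤ HD * (Cu N B θ / 2 * (BD + 2 * √2 * HD)) := by positivity
  rw [le_div_iff₀ hT0] at main
  rw [le_div_iff₀ (by positivity)]
  linarith

end SaddleAveraging

/-! ### The main theorem -/

open SaddleAveraging
theorem mainTheorem1 {N nw dD nm dz : ℕ}
    -- the convex-concave saddle-point problem
    (φ : Payoff N nw dD nm dz)
    (W : Set (EuclideanSpace ℝ (Fin nw))) (𝒟 : Set (EuclideanSpace ℝ (Fin dD)))
    (M : Set (EuclideanSpace ℝ (Fin nm))) (𝒵 : Set (EuclideanSpace ℝ (Fin dz)))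
    (hW : IsClosed W ∧ Convex ℝ W) (h𝒟 : IsClosed 𝒟 ∧ Convex ℝ 𝒟)
    (hM : IsClosed M ∧ Convex ℝ M) (h𝒵 : IsClosed 𝒵 ∧ Convex ℝ 𝒵)
    (hφ : ConvexConcave φ W 𝒟 M 𝒵)
    -- the communication digraphs
    (G : ℕ → WDigraph N) (B : ℕ) (δ Λ : ℝ) (hB : 1 ≤ B) (hδ : 0 < δ)
    (hconn : JointlyConnected G B) (hnondeg : Nondegenerate G δ)
    (hbal : ∀ t, 1 ≤ t → (G t).WeightBalanced)
    (hΛ : ∀ t, 1 ≤ t → sigmaMax (G t).laplacian ≤ Λ)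
    (hdeg : BddAbove (outDegrees G))
    -- the consensus stepsize
    (δ' σ : ℝ) (hδ' : δ' ∈ Set.Ioo (0 : ℝ) 1) (hσ_pos : 0 < σ)
    (hσ : σ ∈ Set.Icc (deltaTilde δ' δ (maxOutDegree G) / δ)
      ((1 - deltaTilde δ' δ (maxOutDegree G)) / maxOutDegree G))
    -- the dynamics, with the learning rates of the Doubling Trick
    (η : ℕ → ℝ) (hη : IsDoublingTrick η)
    (w : ℕ → EuclideanSpace ℝ (Fin nw)) (D : ℕ → Stack N dD)
    (μ : ℕ → EuclideanSpace ℝ (Fin nm)) (z : ℕ → Stack N dz)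
    (gw : ℕ → EuclideanSpace ℝ (Fin nw)) (gD : ℕ → Stack N dD)
    (gμ : ℕ → EuclideanSpace ℝ (Fin nm)) (gz : ℕ → Stack N dz)
    (hdyn : IsDynamics φ W 𝒟 M 𝒵 G σ η w D μ z gw gD gμ gz)
    -- uniform bounds on the estimates and on the subgradients
    (Bw BD Bμ Bz Hw HD Hμ Hz : ℝ)
    (hBw : ∀ t, 1 ≤ t → ‖w t‖ ≤ Bw) (hBD : ∀ t, 1 ≤ t → ‖D t‖ ≤ BD)
    (hBμ : ∀ t, 1 ≤ t → ‖μ t‖ ≤ Bμ) (hBz : ∀ t, 1 ≤ t → ‖z t‖ ≤ Bz)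
    (hHw : ∀ t, 1 ≤ t → ‖gw t‖ ≤ Hw) (hHD : ∀ t, 1 ≤ t → ‖gD t‖ ≤ HD)
    (hHμ : ∀ t, 1 ≤ t → ‖gμ t‖ ≤ Hμ) (hHz : ∀ t, 1 ≤ t → ‖gz t‖ ≤ Hz)
    -- a saddle point with agreement in the second and fourth variables
    (ws : EuclideanSpace ℝ (Fin nw)) (Ds : EuclideanSpace ℝ (Fin dD))
    (μs : EuclideanSpace ℝ (Fin nm)) (zs : EuclideanSpace ℝ (Fin dz))
    (hDs : Ds ∈ 𝒟) (hzs : zs ∈ 𝒵)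
    (hsaddle : IsSaddle φ W 𝒟 M 𝒵 ws (agree N Ds) μs (agree N zs)) :
    ∀ t : ℕ, 2 ≤ t →
      -((evalConst Bμ Bz Hμ Hz σ Λ (Cu N B (deltaTilde δ' δ (maxOutDegree G))) +
          evalConst Bw BD Hw HD σ Λ (Cu N B (deltaTilde δ' δ (maxOutDegree G)))) /
            (2 * √((t : ℝ) - 1))) ≤
        φ (timeAvg w t) (timeAvg D t) (timeAvg μ t) (timeAvg z t) -
          φ ws (agree N Ds) μs (agree N zs) ∧
      φ (timeAvg w t) (timeAvg D t) (timeAvg μ t) (timeAvg z t) -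
          φ ws (agree N Ds) μs (agree N zs) ≤
        (evalConst Bw BD Hw HD σ Λ (Cu N B (deltaTilde δ' δ (maxOutDegree G))) +
          evalConst Bμ Bz Hμ Hz σ Λ (Cu N B (deltaTilde δ' δ (maxOutDegree G)))) /
            (2 * √((t : ℝ) - 1)) := by
  -- If the maximal degree were 0, division by zero would make the upper end of the stepsize
  -- interval 0, against `0 < σ`.
  have hdm : 0 < maxOutDegree G := by
    have h0 : 0 ≤ maxOutDegree G := Real.sSup_nonneg fun r => by
      rintro ⟨t, -, i, rfl⟩
      exact Finset.sum_nonneg fun j _ => (G t).adj_nonneg i j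
    refine h0.lt_of_ne fun h => ?_
    have := hσ.2
    rw [← h, div_zero] at this
    linarith
  -- Without vertices the set of degrees is empty, and its supremum is 0 by convention.
  have hN : N ≠ 0 := by
    rintro rfl
    have : outDegrees G = ∅ := Set.eq_empty_iff_forall_notMem.2 fun r ⟨_, _, i, _⟩ => i.elim0
    rw [maxOutDegree, this, Real.sSup_empty] at hdm
    exact lt_irrefl _ hdm
  set θ := deltaTilde δ' δ (maxOutDegree G) with hθdef
  have hθ : 0 < θ := lt_min hδ'.1 (mul_pos (sub_pos.2 hδ'.2) (div_pos hδ hdm))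
  have hθ1 : θ ≤ 1 := (min_le_left _ _).trans hδ'.2.le
  have hΛ0 : 0 ≤ Λ := le_trans (LinearMap.singularValues_nonneg _ _) (hΛ 1 le_rfl)
  have hP : IsConsensus B θ fun t => 1 - σ • (G t).laplacian :=
    isConsensus_one_sub_smul_laplacian hconn hnondeg hbal hdeg hσ_pos hθ
      ((div_le_iff₀ hδ).1 hσ.1) (by linarith [(le_div_iff₀ hdm).1 hσ.2])
  have hmem : ∀ t, 1 ≤ t → pair (w t) (D t) ∈ pairSet W (stackSet N 𝒟) ∧
      pair (μ t) (z t) ∈ pairSet M (stackSet N 𝒵) := by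
    intro t ht
    induction t, ht using Nat.le_induction with
    | base => exact ⟨⟨hdyn.init.1, hdyn.init.2.1⟩, ⟨hdyn.init.2.2.1, hdyn.init.2.2.2⟩⟩
    | succ t ht _ => exact (hdyn.step t ht).1
  let f : Pair (EuclideanSpace ℝ (Fin nw)) (Stack N dD) →
      Pair (EuclideanSpace ℝ (Fin nm)) (Stack N dz) → ℝ := fun p q => φ p.fst p.snd q.fst q.snd
  have h : IsDescent W 𝒟 (fun t => 1 - σ • (G t).laplacian) η
      (fun t p => f p (pair (μ t) (z t))) w gw D gD Bw BD Hw HD :=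
    { convex_left := hW.2
      convex_right := h𝒟.2
      mem := fun t ht => (hmem t ht).1
      subgradient := hdyn.primal_subgradient
      step_left := fun t ht => (hdyn.step t ht).of_pair.1.of_pair.1
      step_right := fun t ht => by
        rw [blockAct_one_sub_smul]
        exact (hdyn.step t ht).of_pair.1.of_pair.2
      norm_left := hBw
      norm_right := hBD
      norm_subgradient_left := hHw
      norm_subgradient_right := hHD }
  have h' : IsDescent M 𝒵 (fun t => 1 - σ • (G t).laplacian) η
      (fun t q => -f (pair (w t) (D t)) q) μ (fun t => -gμ t) z (fun t => -gz t) Bμ Bz Hμ Hz :=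
    { convex_left := hM.2
      convex_right := h𝒵.2
      mem := fun t ht => (hmem t ht).2
      subgradient := hdyn.dual_subgradient
      step_left := fun t ht => by
        rw [smul_neg, sub_neg_eq_add]
        exact (hdyn.step t ht).of_pair.2.of_pair.1
      step_right := fun t ht => by
        rw [blockAct_one_sub_smul, smul_neg, sub_neg_eq_add]
        exact (hdyn.step t ht).of_pair.2.of_pair.2
      norm_left := hBμ
      norm_right := hBz
      norm_subgradient_left := fun t ht => by rw [norm_neg]; exact hHμ t ht
      norm_subgradient_right := fun t ht => by rw [norm_neg]; exact hHz t ht }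
  have hf : ∀ q ∈ pairSet M (stackSet N 𝒵), ConvexOn ℝ (pairSet W (stackSet N 𝒟)) fun p => f p q :=
    fun q hq => hφ.1 q.fst hq.1 q.snd hq.2
  have hf' : ∀ p ∈ pairSet W (stackSet N 𝒟),
      ConvexOn ℝ (pairSet M (stackSet N 𝒵)) fun q => -f p q :=
    fun p hp => (hφ.2 p.fst hp.1 p.snd hp.2).neg
  obtain ⟨hs, hs', hsad⟩ := hsaddle
  intro t ht
  obtain ⟨T, hT, rfl⟩ : ∃ T, 1 ≤ T ∧ t = T + 1 := ⟨t - 1, by omega, by omega⟩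
  have hcast : ((T + 1 : ℕ) : ℝ) - 1 = T := by push_cast; ring
  rw [hcast]
  constructor
  -- The lower bound is the upper bound for the game `-φ` with the players exchanged.
  · have := value_timeAvg_sub_le (f := fun q p => -f p q) hf' (by simpa only [neg_neg] using hf)
      h' (by simpa only [neg_neg] using h) hN hB hθ hθ1 hP hη hσ_pos.le hΛ0 hs'
      (v := -φ ws (agree N Ds) μs (agree N zs))
      (fun p hp => neg_le_neg (hsad p hp _ hs')) hT
    rw [neg_sub_neg] at this
    rw [neg_le, neg_sub]
    exact this
  · exact value_timeAvg_sub_le hf hf' h h' hN hB hθ hθ1 hP hη hσ_pos.le hΛ0 hs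
      (fun q hq => hsad _ hs q hq) hT
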